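/- Let $(X,d)$ be a complete separable metric space with a locally finite Borel measure $m$ such that $\operatorname{supp} m=X$. Suppose that $(X,d)$ is $CAT(0)$, and that $(X,d,m)$ satisfies $CD(0,N)$ for some $N\in[1,\infty)$ or $CD^e(0,N)$ for some $N\in(0,\infty)$. Suppose that $X$ contains a line, i.e. there is a distance-preserving map $\gamma:\mathbb R\to X$. Then there is a $CAT(0)$ metric space $(Y,d_Y)$ such that $(X,d)$ is isometric to the product $(Y,d_Y)\times(\mathbb R,|\cdot|)$ with the metric $\big(d_Y(y,y')^2+|s-s'|^2\big)^{1/2}$. Here the terms are used as follows. - A metric space is $CAT(0)$ if it is complete and geodesic and, for all points $x,y,z$, every geodesic $[x,z]$ and every $q\in[x,z]$, one has $d(y,q)\le|\bar y-\bar q|$ whenever $\bar x,\bar y,\bar z\in\mathbb R^2$ is a Euclidean triangle with the same side lengths and $\bar q\in[\bar x,\bar z]$ satisfies $|\bar x-\bar q|=d(x,q)$. - $\mathcal P_b(X)$ is the set of Borel probability measures on $X$ with bounded support, with the $L^2$-Wasserstein distance $W_2$; Wasserstein geodesics are constant speed minimizing geodesics $(\mu_t)_{t\in[0,1]}$ in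 $(\mathcal P_b(X),W_2)$. - $CD(0,N)$: for all $\mu_0=\rho_0m$ and $\mu_1=\rho_1m$ in $\mathcal P_b(X)$ there are a Wasserstein geodesic $(\mu_t)$ from $\mu_0$ to $\mu_1$ and an optimal coupling $\pi$ of $\mu_0,\mu_1$ for the cost $d^2$ such that, for all $t\in[0,1]$, $$S_N(\mu_t)\le-\int\Big[(1-t)\rho_0(x)^{-1/N}+t\,\rho_1(y)^{-1/N}\Big]d\pi(x,y),$$ where $S_N(\mu)=-\int_{\{\rho>0\}}\rho^{1-1/N}\,dm$ if $\mu=\rho m$, and $S_N(\mu)=0$ if $\mu$ is not absolutely continuous with respect to $m$. - $CD^e(0,N)$: all $\mu_0,\mu_1\in\mathcal P_b(X)$ with $\mathrm{Ent}_m(\mu_i)<\infty$ are joined by a Wasserstein geodesic $(\mu_t)$ along which $t\mapsto\exp(-\mathrm{Ent}_m(\mu_t)/N)$ is concave on $[0,1]$, where $\mathrm{Ent}_m(\mu)=\int\rho\log\rho\,dm$ if $\mu=\rho m$ and $(\rho\log\rho)_+$ is $m$-integrable, and $\mathrm{Ent}_m(\mu)=\infty$ otherwise. -/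

import Mathlib

open MeasureTheory Set
open scoped ENNReal

universe u

noncomputable section

namespace CATSplitting

/-! ### Geodesics and CAT(0) spaces -/

/-- `γ` restricted to `[0, dist x y]` is a unit speed minimizing geodesic from `x` to `y`. -/
structure IsGeodesic {X : Type u} [MetricSpace X] (γ : ℝ → X) (x y : X) : Prop where
  source : γ 0 = x
  target : γ (dist x y) = y
  dist_eq : ∀ s ∈ Icc (0 : ℝ) (dist x y), ∀ t ∈ Icc (0 : ℝ) (dist x y),
    dist (γ s) (γ t) = |s - t|

/-- A complete geodesic metric space is CAT(0) if the distance from a vertex of a geodesic triangle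
to a point on the opposite side is at most the corresponding distance in a Euclidean comparison
triangle. -/
structure IsCAT0 (X : Type u) [MetricSpace X] : Prop where
  complete : CompleteSpace X
  geodesic : ∀ x y : X, ∃ γ : ℝ → X, IsGeodesic γ x y
  comparison : ∀ (x y z : X) (γ : ℝ → X), IsGeodesic γ x z →
    ∀ t ∈ Icc (0 : ℝ) (dist x z),
    ∀ x' y' z' q' : EuclideanSpace ℝ (Fin 2),
      dist x' y' = dist x y → dist y' z' = dist y z → dist x' z' = dist x z →
      q' ∈ segment ℝ x' z' → dist x' q' = dist x (γ t) →
      dist y (γ t) ≤ dist y' q'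

/-! ### The Wasserstein space -/

section Wasserstein

variable {X : Type u} [MetricSpace X] [MeasurableSpace X]

/-- A Borel probability measure with bounded support (on a separable space its second moments are
then automatically finite). -/
structure IsBddProb (μ : Measure X) : Prop where
  prob : IsProbabilityMeasure μ
  bdd : Bornology.IsBounded μ.support

/-- `π` is a coupling of `μ` and `ν`. -/
def IsCoupling (π : Measure (X × X)) (μ ν : Measure X) : Prop :=
  π.map Prod.fst = μ ∧ π.map Prod.snd = ν

/-- The quadratic transport cost of a coupling. -/
def cost (π : Measure (X × X)) : ℝ≥0∞ := ∫⁻ p, edist p.1 p.2 ^ 2 ∂π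

/-- The `L²`-Wasserstein distance. -/
def W2 (μ ν : Measure X) : ℝ≥0∞ :=
  (⨅ (π : Measure (X × X)) (_ : IsCoupling π μ ν), cost π) ^ (1 / 2 : ℝ)

/-- `π` is a coupling of `μ` and `ν` that minimizes the quadratic cost. -/
def IsOptimalCoupling (π : Measure (X × X)) (μ ν : Measure X) : Prop :=
  IsCoupling π μ ν ∧ ∀ π' : Measure (X × X), IsCoupling π' μ ν → cost π ≤ cost π'

/-- `(μ t)`, `t ∈ [0, 1]`, is a constant speed minimizing geodesic from `μ₀` to `μ₁` in the space of
probability measures with bounded support, with the Wasserstein distance. -/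
structure IsW2Geodesic (μ : ℝ → Measure X) (μ₀ μ₁ : Measure X) : Prop where
  source : μ 0 = μ₀
  target : μ 1 = μ₁
  bddProb : ∀ t ∈ Icc (0 : ℝ) 1, IsBddProb (μ t)
  W2_eq : ∀ s ∈ Icc (0 : ℝ) 1, ∀ t ∈ Icc (0 : ℝ) 1,
    W2 (μ s) (μ t) = ENNReal.ofReal |s - t| * W2 μ₀ μ₁

end Wasserstein

/-! ### Entropies and curvature-dimension conditions -/

section CurvatureDimension

variable {X : Type u} [MetricSpace X] [MeasurableSpace X]

open Classical in
/-- The `N`-Renyi entropy: `S_N(μ | m) = - ∫ ρ ^ (1 - 1 / N) dm` if `μ = ρ m`, and `0` otherwise.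
The integral is over `{ρ ≠ 0}`, which only matters for `N = 1`, where `0 ^ 0` is read as `0`. -/
def renyiEntropy (N : ℝ) (m μ : Measure X) : EReal :=
  if μ ≪ m then
    -((∫⁻ x in {x | μ.rnDeriv m x ≠ 0}, μ.rnDeriv m x ^ (1 - 1 / N) ∂m : ℝ≥0∞) : EReal)
  else 0

/-- The function `ρ log ρ`, where `ρ` is the density of `μ` with respect to `m`. -/
def rhoLogRho (m μ : Measure X) (x : X) : ℝ :=
  (μ.rnDeriv m x).toReal * Real.log (μ.rnDeriv m x).toReal

open Classical in
/-- The Shannon-Boltzmann entropy: `Ent_m(μ) = ∫ ρ log ρ dm` if `μ = ρ m` and the positive part of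
`ρ log ρ` is `m`-integrable, and `∞` otherwise. The integral is the integral of the positive part
minus the integral of the negative part. -/
def entropy (m μ : Measure X) : EReal :=
  if μ ≪ m ∧ ∫⁻ x, ENNReal.ofReal (rhoLogRho m μ x) ∂m ≠ ∞ then
    ((∫⁻ x, ENNReal.ofReal (rhoLogRho m μ x) ∂m : ℝ≥0∞) : EReal) -
      ((∫⁻ x, ENNReal.ofReal (-rhoLogRho m μ x) ∂m : ℝ≥0∞) : EReal)
  else ⊤

/-- `U_N(Ent_m(μ)) = exp (- Ent_m(μ) / N)`. -/
def expEntropy (N : ℝ) (m μ : Measure X) : ℝ≥0∞ :=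
  EReal.exp (-entropy m μ / (N : EReal))

/-- The curvature-dimension condition `CD(0, N)`, for `1 ≤ N < ∞`. For `K = 0` the distortion
coefficient `τ_{K, N}^{(t)}(θ)` is equal to `t`. -/
def CDZero (N : ℝ) (m : Measure X) : Prop :=
  1 ≤ N ∧
  ∀ μ₀ μ₁ : Measure X, IsBddProb μ₀ → IsBddProb μ₁ → μ₀ ≪ m → μ₁ ≪ m →
    ∃ (μ : ℝ → Measure X) (π : Measure (X × X)),
      IsW2Geodesic μ μ₀ μ₁ ∧ IsOptimalCoupling π μ₀ μ₁ ∧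
      ∀ t ∈ Icc (0 : ℝ) 1,
        renyiEntropy N m (μ t) ≤
          -((∫⁻ p, (ENNReal.ofReal (1 - t) * μ₀.rnDeriv m p.1 ^ (-1 / N) +
              ENNReal.ofReal t * μ₁.rnDeriv m p.2 ^ (-1 / N)) ∂π : ℝ≥0∞) : EReal)

/-- The entropic curvature-dimension condition `CD^e(0, N)`, for `0 < N < ∞`: any two measures of
bounded support and finite entropy are joined by a Wasserstein geodesic along which `Ent_m` is
`(0, N)`-convex, that is, along which `exp (- Ent_m / N)` is concave. -/
def CDeZero (N : ℝ) (m : Measure X) : Prop :=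
  0 < N ∧
  ∀ μ₀ μ₁ : Measure X, IsBddProb μ₀ → IsBddProb μ₁ → entropy m μ₀ < ⊤ → entropy m μ₁ < ⊤ →
    ∃ μ : ℝ → Measure X, IsW2Geodesic μ μ₀ μ₁ ∧
      ∀ s ∈ Icc (0 : ℝ) 1, ∀ t ∈ Icc (0 : ℝ) 1, ∀ a ∈ Icc (0 : ℝ) 1,
        ENNReal.ofReal (1 - a) * expEntropy N m (μ s) + ENNReal.ofReal a * expEntropy N m (μ t) ≤
          expEntropy N m (μ ((1 - a) * s + a * t))

end CurvatureDimension

end CATSplitting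

end

namespace CATSplitting

/-! ### Geometry of CAT(0) spaces -/

section Geometry

variable {X : Type u} [MetricSpace X]

/-- The point at fraction `t` of a chosen geodesic from `x` to `y`. -/
noncomputable def IsCAT0.point (hX : IsCAT0 X) (t : ℝ) (x y : X) : X :=
  (hX.geodesic x y).choose (t * dist x y)

theorem exists_comparison_triangle {a b c : ℝ} (ha : 0 ≤ a) (hc : 0 < c)
    (hb : 0 ≤ b) (h1 : a ≤ b + c) (h2 : b ≤ a + c) (h3 : c ≤ a + b) :
    ∃ p q : ℝ, p ^ 2 + q ^ 2 = a ^ 2 ∧ (p - c) ^ 2 + q ^ 2 = b ^ 2 := by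
  have hp : ((a ^ 2 + c ^ 2 - b ^ 2) / (2 * c)) ^ 2 ≤ a ^ 2 := by
    apply sq_le_sq'
    · rw [le_div_iff₀ (by positivity)]; nlinarith
    · rw [div_le_iff₀ (by positivity)]; nlinarith
  refine ⟨(a ^ 2 + c ^ 2 - b ^ 2) / (2 * c),
    Real.sqrt (a ^ 2 - ((a ^ 2 + c ^ 2 - b ^ 2) / (2 * c)) ^ 2), ?_, ?_⟩
  · rw [Real.sq_sqrt (by linarith)]; ring
  · rw [Real.sq_sqrt (by linarith)]; field_simp; ring

theorem dist_vec2 (a b c d : ℝ) :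
    dist (!₂[a, b] : EuclideanSpace ℝ (Fin 2)) !₂[c, d] = Real.sqrt ((a - c) ^ 2 + (b - d) ^ 2) := by
  simp [EuclideanSpace.dist_eq, Real.dist_eq, sq_abs]

theorem dist_vec2_eq {a b c d r : ℝ} (hr : 0 ≤ r) (h : (a - c) ^ 2 + (b - d) ^ 2 = r ^ 2) :
    dist (!₂[a, b] : EuclideanSpace ℝ (Fin 2)) !₂[c, d] = r := by
  rw [dist_vec2, h, Real.sqrt_sq hr]

theorem IsCAT0.dist_sq_le_of_isGeodesic (hX : IsCAT0 X) {x z : X} {γ : ℝ → X}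
    (hγ : IsGeodesic γ x z) {t : ℝ} (ht : t ∈ Icc (0 : ℝ) 1) (y : X) :
    dist y (γ (t * dist x z)) ^ 2 ≤
      (1 - t) * dist y x ^ 2 + t * dist y z ^ 2 - t * (1 - t) * dist x z ^ 2 := by
  rcases eq_or_ne x z with rfl | hne
  · simp only [dist_self, mul_zero, hγ.source]
    exact le_of_eq (by ring)
  have hc : 0 < dist x z := dist_pos.2 hne
  obtain ⟨p, q, hp, hq⟩ := exists_comparison_triangle (a := dist x y) (b := dist y z) dist_nonneg hc
    dist_nonneg (by rw [dist_comm y z, add_comm]; exact dist_triangle x z y)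
    (by rw [dist_comm x y]; exact dist_triangle y x z) (dist_triangle x y z)
  have hmem : t * dist x z ∈ Icc (0 : ℝ) (dist x z) :=
    ⟨mul_nonneg ht.1 hc.le, mul_le_of_le_one_left hc.le ht.2⟩
  have hd : dist x (γ (t * dist x z)) = t * dist x z := by
    have := hγ.dist_eq 0 ⟨le_rfl, hc.le⟩ _ hmem
    rwa [hγ.source, zero_sub, abs_neg, abs_of_nonneg hmem.1] at this
  have := hX.comparison x y z γ hγ (t * dist x z) hmem !₂[0, 0] !₂[p, q] !₂[dist x z, 0]
    !₂[t * dist x z, 0]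
    (dist_vec2_eq dist_nonneg (by linarith [hp]))
    (dist_vec2_eq dist_nonneg (by linarith [hq]))
    (dist_vec2_eq dist_nonneg (by ring))
    ⟨1 - t, t, by linarith [ht.2], ht.1, by ring, by
      ext i; fin_cases i <;> simp⟩
    (by rw [hd]; exact dist_vec2_eq hmem.1 (by ring))
  rw [dist_vec2] at this
  have h2 := pow_le_pow_left₀ dist_nonneg this 2
  rw [Real.sq_sqrt (by positivity)] at h2
  rw [dist_comm y x, ← hp, ← hq]
  exact h2.trans_eq (by ring)

theorem IsCAT0.dist_sq_point_le (hX : IsCAT0 X) {t : ℝ} (ht : t ∈ Icc (0 : ℝ) 1) (w x y : X) :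
    dist w (hX.point t x y) ^ 2 ≤
      (1 - t) * dist w x ^ 2 + t * dist w y ^ 2 - t * (1 - t) * dist x y ^ 2 :=
  hX.dist_sq_le_of_isGeodesic (hX.geodesic x y).choose_spec ht w

theorem IsCAT0.dist_left_point (hX : IsCAT0 X) {t : ℝ} (ht : t ∈ Icc (0 : ℝ) 1) (x y : X) :
    dist x (hX.point t x y) = t * dist x y := by
  have h := (hX.geodesic x y).choose_spec
  have hmem : t * dist x y ∈ Icc (0 : ℝ) (dist x y) :=
    ⟨mul_nonneg ht.1 dist_nonneg, mul_le_of_le_one_left dist_nonneg ht.2⟩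
  have := h.dist_eq 0 ⟨le_rfl, dist_nonneg⟩ _ hmem
  rwa [h.source, zero_sub, abs_neg, abs_of_nonneg hmem.1] at this

theorem IsCAT0.dist_point_right (hX : IsCAT0 X) {t : ℝ} (ht : t ∈ Icc (0 : ℝ) 1) (x y : X) :
    dist (hX.point t x y) y = (1 - t) * dist x y := by
  have h := (hX.geodesic x y).choose_spec
  have hmem : t * dist x y ∈ Icc (0 : ℝ) (dist x y) :=
    ⟨mul_nonneg ht.1 dist_nonneg, mul_le_of_le_one_left dist_nonneg ht.2⟩
  have := h.dist_eq _ hmem _ ⟨dist_nonneg, le_rfl⟩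
  rw [h.target, abs_of_nonpos (by linarith [hmem.2])] at this
  unfold IsCAT0.point
  rw [this]; ring

theorem IsCAT0.eq_point (hX : IsCAT0 X) {t : ℝ} (ht : t ∈ Icc (0 : ℝ) 1) {w x y : X}
    (h1 : dist x w = t * dist x y) (h2 : dist w y = (1 - t) * dist x y) :
    w = hX.point t x y := by
  have h := hX.dist_sq_point_le ht w x y
  rw [dist_comm w x, h1, h2] at h
  have : dist w (hX.point t x y) ^ 2 ≤ 0 := by nlinarith
  exact dist_eq_zero.1 (by nlinarith [dist_nonneg (x := w) (y := hX.point t x y)])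

theorem IsCAT0.point_symm (hX : IsCAT0 X) {t : ℝ} (ht : t ∈ Icc (0 : ℝ) 1) (x y : X) :
    hX.point t x y = hX.point (1 - t) y x := by
  apply hX.eq_point ⟨by linarith [ht.2], by linarith [ht.1]⟩
  · rw [dist_comm, hX.dist_point_right ht, dist_comm x y]
  · rw [dist_comm, hX.dist_left_point ht, dist_comm x y]; ring

theorem IsCAT0.dist_point_point_left (hX : IsCAT0 X) {t : ℝ} (ht : t ∈ Icc (0 : ℝ) 1) (x y y' : X) :
    dist (hX.point t x y) (hX.point t x y') ≤ t * dist y y' := by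
  have h1 := hX.dist_sq_point_le ht (hX.point t x y') x y
  have h2 := hX.dist_sq_point_le ht y x y'
  rw [dist_comm _ x, hX.dist_left_point ht, dist_comm _ y] at h1
  rw [dist_comm y x] at h2
  rw [dist_comm]
  apply abs_le_of_sq_le_sq' _ (mul_nonneg ht.1 dist_nonneg) |>.2
  nlinarith [mul_le_mul_of_nonneg_left h2 ht.1]

theorem IsCAT0.dist_point_point_right (hX : IsCAT0 X) {t : ℝ} (ht : t ∈ Icc (0 : ℝ) 1)
    (x x' y : X) : dist (hX.point t x y) (hX.point t x' y) ≤ (1 - t) * dist x x' := by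
  rw [hX.point_symm ht, hX.point_symm ht]
  exact hX.dist_point_point_left ⟨by linarith [ht.2], by linarith [ht.1]⟩ _ _ _

/-- Two points of the same geodesic. -/
theorem IsCAT0.dist_point_point (hX : IsCAT0 X) {s t : ℝ} (hs : s ∈ Icc (0 : ℝ) 1)
    (ht : t ∈ Icc (0 : ℝ) 1) (x y : X) :
    dist (hX.point s x y) (hX.point t x y) = |s - t| * dist x y := by
  have hmem : ∀ t ∈ Icc (0 : ℝ) 1, t * dist x y ∈ Icc (0 : ℝ) (dist x y) := fun t ht =>
    ⟨mul_nonneg ht.1 dist_nonneg, mul_le_of_le_one_left dist_nonneg ht.2⟩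
  have := (hX.geodesic x y).choose_spec.dist_eq _ (hmem s hs) _ (hmem t ht)
  unfold IsCAT0.point
  rw [this, ← sub_mul, abs_mul, abs_of_nonneg (dist_nonneg (x := x))]

/-- Iterated homotheties with the same centre. -/
theorem IsCAT0.point_point (hX : IsCAT0 X) {s t : ℝ} (hs : s ∈ Icc (0 : ℝ) 1)
    (ht : t ∈ Icc (0 : ℝ) 1) (x y : X) :
    hX.point s x (hX.point t x y) = hX.point (s * t) x y := by
  have hst : s * t ∈ Icc (0 : ℝ) 1 := ⟨mul_nonneg hs.1 ht.1, mul_le_one₀ hs.2 ht.1 ht.2⟩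
  have h1 : dist x (hX.point s x (hX.point t x y)) = s * t * dist x y := by
    rw [hX.dist_left_point hs, hX.dist_left_point ht]; ring
  refine hX.eq_point hst h1 (le_antisymm ?_ ?_)
  · refine (dist_triangle _ (hX.point t x y) _).trans ?_
    rw [hX.dist_point_right hs, hX.dist_point_right ht, hX.dist_left_point ht]
    apply le_of_eq; ring
  · have := dist_triangle x (hX.point s x (hX.point t x y)) y
    rw [h1] at this
    linarith

/-- The sum of the squares of the diagonals of a quadrilateral is at most the sum of the squares of
its sides. -/
theorem IsCAT0.quadrilateral (hX : IsCAT0 X) (x₁ x₂ x₃ x₄ : X) :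
    dist x₁ x₃ ^ 2 + dist x₂ x₄ ^ 2 ≤
      dist x₁ x₂ ^ 2 + dist x₂ x₃ ^ 2 + dist x₃ x₄ ^ 2 + dist x₁ x₄ ^ 2 := by
  have hh : (1 / 2 : ℝ) ∈ Icc (0 : ℝ) 1 := by norm_num
  have h2 := hX.dist_sq_point_le hh x₂ x₁ x₃
  have h4 := hX.dist_sq_point_le hh x₄ x₁ x₃
  have h := dist_triangle_right x₂ x₄ (hX.point (1 / 2) x₁ x₃)
  rw [dist_comm x₂ x₁] at h2
  rw [dist_comm x₄ x₁, dist_comm x₄ x₃] at h4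
  nlinarith [sq_nonneg (dist x₂ (hX.point (1 / 2) x₁ x₃) - dist x₄ (hX.point (1 / 2) x₁ x₃)),
    pow_le_pow_left₀ dist_nonneg h 2]

end Geometry

/-! ### Couplings and Wasserstein geodesics -/

theorem IsCAT0.infEDist_sq_add_le {X : Type u} [MetricSpace X] (hX : IsCAT0 X) {t : ℝ} (ht : t ∈ Icc (0 : ℝ) 1) {E : Set X}
    {x y : X} (h : hX.point t x y ∈ E) (z : X) :
    Metric.infEDist z E ^ 2 + ENNReal.ofReal (t * (1 - t)) * edist x y ^ 2 ≤
      ENNReal.ofReal (1 - t) * edist x z ^ 2 + ENNReal.ofReal t * edist z y ^ 2 := by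
  have h1 : Metric.infEDist z E ^ 2 ≤ edist z (hX.point t x y) ^ 2 := by
    gcongr; exact Metric.infEDist_le_edist_of_mem h
  have ht' : 0 ≤ 1 - t := by linarith [ht.2]
  refine (add_le_add_left h1 _).trans ?_
  simp only [edist_dist, ← ENNReal.ofReal_pow dist_nonneg]
  rw [← ENNReal.ofReal_mul (mul_nonneg ht.1 ht'), ← ENNReal.ofReal_mul ht', ← ENNReal.ofReal_mul ht.1,
    ← ENNReal.ofReal_add (sq_nonneg _) (by have := ht.1; positivity),
    ← ENNReal.ofReal_add (by positivity) (by have := ht.1; positivity)]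
  apply ENNReal.ofReal_le_ofReal
  rw [dist_comm x z]
  linarith [hX.dist_sq_point_le ht z x y]

section Transport

open ProbabilityTheory

variable {X : Type u} [MeasurableSpace X]

/-- Gluing of two couplings with a common marginal, which is the law of the first coordinate. -/
theorem exists_gluing [StandardBorelSpace X] {μ ν ξ : Measure X}
    [IsProbabilityMeasure ν] {π₁ π₂ : Measure (X × X)}
    (h₁ : IsCoupling π₁ μ ν) (h₂ : IsCoupling π₂ ν ξ) :
    ∃ Γ : Measure (X × X × X), Γ.map (fun p => (p.2.1, p.1)) = π₁ ∧
      Γ.map (fun p => (p.1, p.2.2)) = π₂ := by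
  have : Nonempty X := nonempty_of_isProbabilityMeasure ν
  have f₁ : (π₁.map Prod.swap).fst = ν := by
    rw [Measure.fst_map_swap]; exact h₁.2
  have f₂ : π₂.fst = ν := h₂.1
  have i₂ : IsProbabilityMeasure π₂ := ⟨by rw [← Measure.fst_univ, f₂, measure_univ]⟩
  have i₁ : IsProbabilityMeasure (π₁.map Prod.swap) :=
    ⟨by rw [← Measure.fst_univ, f₁, measure_univ]⟩
  have d₁ : ν ⊗ₘ (π₁.map Prod.swap).condKernel = π₁.map Prod.swap := by
    conv_lhs => rw [← f₁]
    exact Measure.disintegrate _ _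
  have d₂ : ν ⊗ₘ π₂.condKernel = π₂ := by
    conv_lhs => rw [← f₂]
    exact Measure.disintegrate _ _
  refine ⟨ν ⊗ₘ ((π₁.map Prod.swap).condKernel ×ₖ π₂.condKernel), ?_, ?_⟩
  · have : (fun p : X × X × X => (p.2.1, p.1)) = Prod.swap ∘ Prod.map id Prod.fst := rfl
    rw [this, ← Measure.map_map measurable_swap (by fun_prop),
      ← Measure.compProd_map (by fun_prop), ← Kernel.fst_eq, Kernel.fst_prod, d₁,
      Measure.map_map measurable_swap measurable_swap]
    simp
  · have : (fun p : X × X × X => (p.1, p.2.2)) = Prod.map id Prod.snd := rfl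
    rw [this, ← Measure.compProd_map (by fun_prop), ← Kernel.snd_eq, Kernel.snd_prod, d₂]

theorem IsCoupling.ae_fst {μ ν : Measure X} {π : Measure (X × X)} (h : IsCoupling π μ ν)
    {p : X → Prop} (hp : ∀ᵐ x ∂μ, p x) : ∀ᵐ z ∂π, p z.1 := by
  rw [← h.1] at hp
  exact ae_of_ae_map measurable_fst.aemeasurable hp

theorem IsCoupling.ae_snd {μ ν : Measure X} {π : Measure (X × X)} (h : IsCoupling π μ ν)
    {p : X → Prop} (hp : ∀ᵐ x ∂ν, p x) : ∀ᵐ z ∂π, p z.2 := by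
  rw [← h.2] at hp
  exact ae_of_ae_map measurable_snd.aemeasurable hp

variable [MetricSpace X]

/-- The infimum of the quadratic costs of couplings. -/
noncomputable def transportCost (μ ν : Measure X) : ℝ≥0∞ :=
  ⨅ (π : Measure (X × X)) (_ : IsCoupling π μ ν), cost π

theorem transportCost_le_cost {μ ν : Measure X} {π : Measure (X × X)} (h : IsCoupling π μ ν) :
    transportCost μ ν ≤ cost π := iInf₂_le π h

theorem exists_coupling_cost_le {μ ν : Measure X} (h : transportCost μ ν ≠ ∞) {η : ℝ≥0∞}
    (hη : η ≠ 0) : ∃ π, IsCoupling π μ ν ∧ cost π ≤ transportCost μ ν + η := by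
  have := ENNReal.lt_add_right h hη
  conv_lhs at this => unfold transportCost
  simp only [iInf_lt_iff] at this
  obtain ⟨π, hπ, hlt⟩ := this
  exact ⟨π, hπ, hlt.le⟩

theorem IsW2Geodesic.transportCost_eq {μ : ℝ → Measure X} {μ₀ μ₁ : Measure X}
    (h : IsW2Geodesic μ μ₀ μ₁) {s t : ℝ} (hs : s ∈ Icc (0 : ℝ) 1) (ht : t ∈ Icc (0 : ℝ) 1) :
    transportCost (μ s) (μ t) = ENNReal.ofReal ((s - t) ^ 2) * transportCost μ₀ μ₁ := by
  have h2 := congrArg (· ^ (2 : ℝ)) (h.W2_eq s hs t ht)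
  simp only [W2, ENNReal.mul_rpow_of_nonneg _ _ (zero_le_two (α := ℝ)),
    ← ENNReal.rpow_mul] at h2
  norm_num at h2
  unfold transportCost
  rw [h2, ← ENNReal.ofReal_pow (abs_nonneg _), sq_abs]

theorem transportCost_ne_top {μ ν : Measure X} [IsProbabilityMeasure μ] [IsProbabilityMeasure ν]
    {A B : Set X} (hA : Bornology.IsBounded A) (hB : Bornology.IsBounded B)
    (hμ : ∀ᵐ x ∂μ, x ∈ A) (hν : ∀ᵐ x ∂ν, x ∈ B) : transportCost μ ν ≠ ∞ := by
  have hc : IsCoupling (μ.prod ν) μ ν := by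
    constructor <;> simp
  refine ne_top_of_le_ne_top ?_ (transportCost_le_cost hc)
  obtain ⟨D, hD⟩ := Metric.isBounded_iff.1 (hA.union hB)
  have : ∀ᵐ p ∂μ.prod ν, edist p.1 p.2 ^ 2 ≤ ENNReal.ofReal D ^ 2 := by
    filter_upwards [hc.ae_fst hμ, hc.ae_snd hν] with p h1 h2
    gcongr
    rw [edist_dist]
    exact ENNReal.ofReal_le_ofReal (hD (Or.inl h1) (Or.inr h2))
  refine ne_top_of_le_ne_top ?_ (lintegral_mono_ae this)
  simp

/-- A Wasserstein geodesic is concentrated on the intermediate points. -/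
theorem IsW2Geodesic.ae_mem [SecondCountableTopology X] [BorelSpace X] (hX : IsCAT0 X)
    {μ : ℝ → Measure X} {μ₀ μ₁ : Measure X} (hμ : IsW2Geodesic μ μ₀ μ₁)
    {A B : Set X} (hA : Bornology.IsBounded A) (hB : Bornology.IsBounded B)
    (h₀ : ∀ᵐ x ∂μ₀, x ∈ A) (h₁ : ∀ᵐ x ∂μ₁, x ∈ B) {t : ℝ} (ht : t ∈ Icc (0 : ℝ) 1)
    {E : Set X} (hE : IsClosed E) (hABE : ∀ x ∈ A, ∀ y ∈ B, hX.point t x y ∈ E) :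
    ∀ᵐ z ∂(μ t), z ∈ E := by
  have := hX.complete
  have z01 : (0 : ℝ) ∈ Icc (0 : ℝ) 1 := by simp
  have o01 : (1 : ℝ) ∈ Icc (0 : ℝ) 1 := by simp
  have ip := (hμ.bddProb t ht).prob
  have i0 : IsProbabilityMeasure μ₀ := hμ.source ▸ (hμ.bddProb 0 z01).prob
  have i1 : IsProbabilityMeasure μ₁ := hμ.target ▸ (hμ.bddProb 1 o01).prob
  have hC : transportCost μ₀ μ₁ ≠ ∞ := transportCost_ne_top hA hB h₀ h₁
  have ht' : 0 ≤ 1 - t := by linarith [ht.2]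
  have c₁ := hμ.transportCost_eq z01 ht
  have c₂ := hμ.transportCost_eq ht o01
  rw [hμ.source, show (0 - t) ^ 2 = t ^ 2 by ring] at c₁
  rw [hμ.target, show (t - 1) ^ 2 = (1 - t) ^ 2 by ring] at c₂
  have hcont : Measurable fun z : X => Metric.infEDist z E ^ 2 :=
    (Metric.continuous_infEDist.measurable).pow_const 2
  have key : ∀ η : ℝ≥0∞, η ≠ 0 → ∫⁻ z, Metric.infEDist z E ^ 2 ∂(μ t) ≤ 0 + η := by
    intro η hη
    obtain ⟨π₁, hπ₁, hc₁⟩ := exists_coupling_cost_le (μ := μ₀) (ν := μ t)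
      (by rw [c₁]; exact ENNReal.mul_ne_top ENNReal.ofReal_ne_top hC) hη
    obtain ⟨π₂, hπ₂, hc₂⟩ := exists_coupling_cost_le (μ := μ t) (ν := μ₁)
      (by rw [c₂]; exact ENNReal.mul_ne_top ENNReal.ofReal_ne_top hC) hη
    rw [c₁] at hc₁
    rw [c₂] at hc₂
    obtain ⟨Γ, hΓ₁, hΓ₂⟩ := exists_gluing hπ₁ hπ₂
    have m₁ : Measurable (fun p : X × X × X => (p.2.1, p.1)) := by fun_prop
    have m₂ : Measurable (fun p : X × X × X => (p.1, p.2.2)) := by fun_prop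
    have md : Measurable fun p : X × X => edist p.1 p.2 ^ 2 :=
      (measurable_fst.edist measurable_snd).pow_const 2
    have e₁ : cost π₁ = ∫⁻ p, edist p.2.1 p.1 ^ 2 ∂Γ := by
      rw [cost, ← hΓ₁, lintegral_map md m₁]
    have e₂ : cost π₂ = ∫⁻ p, edist p.1 p.2.2 ^ 2 ∂Γ := by
      rw [cost, ← hΓ₂, lintegral_map md m₂]
    have e₃ : ∫⁻ z, Metric.infEDist z E ^ 2 ∂(μ t) = ∫⁻ p, Metric.infEDist p.1 E ^ 2 ∂Γ := by
      rw [← hπ₂.1, ← hΓ₂, Measure.map_map measurable_fst m₂, lintegral_map hcont (by fun_prop)]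
      rfl
    have hc : IsCoupling (Γ.map Prod.snd) μ₀ μ₁ := by
      constructor
      · rw [← hπ₁.1, ← hΓ₁, Measure.map_map (by fun_prop) (by fun_prop),
          Measure.map_map (by fun_prop) (by fun_prop)]
        rfl
      · rw [← hπ₂.2, ← hΓ₂, Measure.map_map (by fun_prop) (by fun_prop),
          Measure.map_map (by fun_prop) (by fun_prop)]
        rfl
    have e₄ : transportCost μ₀ μ₁ ≤ ∫⁻ p, edist p.2.1 p.2.2 ^ 2 ∂Γ := by
      refine (transportCost_le_cost hc).trans_eq ?_
      rw [cost, lintegral_map md (by fun_prop)]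
    have hae : ∀ᵐ p ∂Γ, Metric.infEDist p.1 E ^ 2 +
        ENNReal.ofReal (t * (1 - t)) * edist p.2.1 p.2.2 ^ 2 ≤
        ENNReal.ofReal (1 - t) * edist p.2.1 p.1 ^ 2 + ENNReal.ofReal t * edist p.1 p.2.2 ^ 2 := by
      filter_upwards [ae_of_ae_map (by fun_prop) (hc.ae_fst h₀),
        ae_of_ae_map (by fun_prop) (hc.ae_snd h₁)] with p hp hq
      exact hX.infEDist_sq_add_le ht (hABE _ hp _ hq) _
    have hint := lintegral_mono_ae hae
    have m₃ : Measurable fun p : X × X × X => edist p.2.1 p.1 ^ 2 := md.comp m₁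
    have m₄ : Measurable fun p : X × X × X => edist p.1 p.2.2 ^ 2 := md.comp m₂
    rw [lintegral_add_left (by exact hcont.comp measurable_fst), lintegral_const_mul _ (by exact md.comp measurable_snd),
      lintegral_add_left (m₃.const_mul _), lintegral_const_mul _ m₃, lintegral_const_mul _ m₄,
      ← e₁, ← e₂, ← e₃] at hint
    set C := transportCost μ₀ μ₁
    have hfin : ENNReal.ofReal (t * (1 - t)) * C ≠ ∞ := ENNReal.mul_ne_top ENNReal.ofReal_ne_top hC
    rw [zero_add]
    refine (ENNReal.add_le_add_iff_right hfin).1 ?_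
    calc _ ≤ ∫⁻ z, Metric.infEDist z E ^ 2 ∂(μ t) +
          ENNReal.ofReal (t * (1 - t)) * ∫⁻ p, edist p.2.1 p.2.2 ^ 2 ∂Γ := by gcongr
      _ ≤ _ := hint
      _ ≤ ENNReal.ofReal (1 - t) * (ENNReal.ofReal (t ^ 2) * C + η) +
          ENNReal.ofReal t * (ENNReal.ofReal ((1 - t) ^ 2) * C + η) := by gcongr
      _ = (ENNReal.ofReal (1 - t) + ENNReal.ofReal t) * η +
          (ENNReal.ofReal (1 - t) * ENNReal.ofReal (t ^ 2) +
            ENNReal.ofReal t * ENNReal.ofReal ((1 - t) ^ 2)) * C := by ring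
      _ = η + ENNReal.ofReal (t * (1 - t)) * C := by
        have := ht.1
        rw [← ENNReal.ofReal_mul ht', ← ENNReal.ofReal_mul ht.1,
          ← ENNReal.ofReal_add ht' ht.1, ← ENNReal.ofReal_add (by positivity) (by positivity)]
        congr 2
        · simp
        · congr 1; ring
  have h0 : ∫⁻ z, Metric.infEDist z E ^ 2 ∂(μ t) = 0 := by
    apply le_antisymm _ zero_le
    exact ENNReal.le_of_forall_pos_le_add fun ε hε _ => key ε (by simpa using hε.ne')
  rw [lintegral_eq_zero_iff hcont] at h0
  filter_upwards [h0] with z hz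
  rw [Metric.mem_iff_infEDist_zero_of_closed hE]
  simpa using hz

end Transport

/-! ### Entropies of uniform distributions and a Brunn-Minkowski inequality -/

section Entropy

variable {X : Type u} [MeasurableSpace X]

/-- The uniform distribution on a set of finite positive measure. -/
noncomputable def uniformOn (m : Measure X) (A : Set X) : Measure X :=
  m.withDensity (A.indicator fun _ => (m A)⁻¹)

section

variable {m : Measure X} {A : Set X}

theorem uniformOn_ac : uniformOn m A ≪ m := withDensity_absolutelyContinuous _ _

theorem uniformOn_apply_self (hA : MeasurableSet A) (h0 : m A ≠ 0) (h1 : m A ≠ ∞) : uniformOn m A A = 1 := by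
  rw [uniformOn, withDensity_apply _ hA, setLIntegral_indicator hA, inter_self,
    setLIntegral_const, ENNReal.inv_mul_cancel h0 h1]

theorem uniformOn_compl (hA : MeasurableSet A) : uniformOn m A Aᶜ = 0 := by
  rw [uniformOn, withDensity_apply _ hA.compl, setLIntegral_indicator hA, inter_compl_self]
  simp

theorem ae_mem_uniformOn (hA : MeasurableSet A) : ∀ᵐ x ∂uniformOn m A, x ∈ A := uniformOn_compl hA

theorem isProbabilityMeasure_uniformOn (hA : MeasurableSet A) (h0 : m A ≠ 0) (h1 : m A ≠ ∞) :
    IsProbabilityMeasure (uniformOn m A) :=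
  ⟨by rw [← measure_add_measure_compl hA, uniformOn_apply_self hA h0 h1, uniformOn_compl hA, add_zero]⟩

theorem rnDeriv_uniformOn [SigmaFinite m] (hA : MeasurableSet A) :
    (uniformOn m A).rnDeriv m =ᵐ[m] A.indicator fun _ => (m A)⁻¹ :=
  Measure.rnDeriv_withDensity _ (measurable_const.indicator hA)

end

/-- Hölder's inequality for the Renyi entropy. -/
theorem le_measure_rpow_of_renyiEntropy_le {m μ : Measure X} [SigmaFinite m] [IsProbabilityMeasure μ]
    {E : Set X} (hE : MeasurableSet E) (hμE : ∀ᵐ x ∂μ, x ∈ E) {N : ℝ} (hN : 1 ≤ N) {a : ℝ≥0∞}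
    (h : renyiEntropy N m μ ≤ -(a : EReal)) : a ≤ m E ^ (1 / N) := by
  by_cases hac : μ ≪ m
  · rw [renyiEntropy, if_pos hac, EReal.neg_le_neg_iff, EReal.coe_ennreal_le_coe_ennreal_iff] at h
    refine h.trans ?_
    have hmeas := Measure.measurable_rnDeriv μ m
    have hS : MeasurableSet {x | μ.rnDeriv m x ≠ 0} := hmeas (measurableSet_singleton 0).compl
    have hsub : ({x | μ.rnDeriv m x ≠ 0} : Set X) ≤ᵐ[m] E := by
      have : ∫⁻ x in Eᶜ, μ.rnDeriv m x ∂m = 0 := by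
        rw [Measure.setLIntegral_rnDeriv hac]; exact hμE
      rw [lintegral_eq_zero_iff hmeas, Filter.EventuallyEq, ae_restrict_iff' hE.compl] at this
      filter_upwards [this] with x hx h1
      by_contra h2
      exact h1 (hx h2)
    have hN' : 1 / N ≤ 1 := by rw [div_le_one (by linarith)]; exact hN
    calc _ ≤ ∫⁻ x in E, μ.rnDeriv m x ^ (1 - 1 / N) ∂m := lintegral_mono_set' hsub
      _ = ∫⁻ x in E, μ.rnDeriv m x ^ (1 - 1 / N) * (1 : ℝ≥0∞) ^ (1 / N) ∂m := by simp
      _ ≤ (∫⁻ x in E, μ.rnDeriv m x ∂m) ^ (1 - 1 / N) * (∫⁻ x in E, 1 ∂m) ^ (1 / N) :=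
        ENNReal.lintegral_mul_norm_pow_le hmeas.aemeasurable aemeasurable_const
          (by linarith) (by positivity) (by ring)
      _ ≤ 1 * m E ^ (1 / N) := by
        gcongr
        · apply ENNReal.rpow_le_one _ (by linarith)
          rw [Measure.setLIntegral_rnDeriv hac]
          exact prob_le_one
        · simp
      _ = m E ^ (1 / N) := one_mul _
  · rw [renyiEntropy, if_neg hac, ← neg_zero, EReal.neg_le_neg_iff] at h
    have : a = 0 := le_antisymm (by exact_mod_cast h) zero_le
    simp [this]

/-- The density of a uniform distribution, integrated against a coupling. -/
theorem le_lintegral_rnDeriv_uniformOn {m μ₀ : Measure X} [SigmaFinite m] {B : Set X}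
    (hB : MeasurableSet B) (h0 : m B ≠ 0) (h1 : m B ≠ ∞) {π : Measure (X × X)}
    (hπ : IsCoupling π μ₀ (uniformOn m B)) (N t : ℝ) (f : X × X → ℝ≥0∞) :
    ENNReal.ofReal t * m B ^ (1 / N) ≤
      ∫⁻ p, (f p + ENNReal.ofReal t * (uniformOn m B).rnDeriv m p.2 ^ (-1 / N)) ∂π := by
  have := isProbabilityMeasure_uniformOn hB h0 h1
  have hπ1 : π univ = 1 := by
    have := congrArg (fun μ => μ univ) hπ.2
    simpa [Measure.map_apply measurable_snd MeasurableSet.univ] using this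
  have hae : ∀ᵐ x ∂uniformOn m B, (uniformOn m B).rnDeriv m x = (m B)⁻¹ := by
    filter_upwards [uniformOn_ac.ae_le (rnDeriv_uniformOn hB), ae_mem_uniformOn hB] with x hx hxB
    rw [hx, indicator_of_mem hxB]
  calc _ = ∫⁻ _, ENNReal.ofReal t * m B ^ (1 / N) ∂π := by simp [hπ1]
    _ ≤ _ := by
      apply lintegral_mono_ae
      filter_upwards [hπ.ae_snd hae] with p hp
      rw [hp, ENNReal.inv_rpow, neg_div, ENNReal.rpow_neg, inv_inv]
      exact le_add_self

theorem entropy_uniformOn {m : Measure X} [SigmaFinite m] {A : Set X} (hA : MeasurableSet A)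
    (h0 : m A ≠ 0) (h1 : m A ≠ ∞) :
    entropy m (uniformOn m A) = ((-Real.log (m A).toReal : ℝ) : EReal) := by
  set v := (m A).toReal
  have hv : 0 < v := ENNReal.toReal_pos h0 h1
  have hae : rhoLogRho m (uniformOn m A) =ᵐ[m] A.indicator fun _ => -(v⁻¹ * Real.log v) := by
    filter_upwards [rnDeriv_uniformOn hA] with x hx
    rw [rhoLogRho, hx]
    by_cases h : x ∈ A
    · simp [h, ENNReal.toReal_inv, v]
    · simp [h]
  have hint : ∀ s : ℝ, ∫⁻ x, ENNReal.ofReal (s * rhoLogRho m (uniformOn m A) x) ∂m =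
      ENNReal.ofReal (-(s * Real.log v)) := by
    intro s
    have : ∀ᵐ x ∂m, ENNReal.ofReal (s * rhoLogRho m (uniformOn m A) x) =
        A.indicator (fun _ => ENNReal.ofReal (-(s * (v⁻¹ * Real.log v)))) x := by
      filter_upwards [hae] with x hx
      rw [hx]
      by_cases h : x ∈ A <;> simp [h]
    rw [lintegral_congr_ae this, lintegral_indicator hA, setLIntegral_const,
      ← ENNReal.ofReal_toReal h1, ← ENNReal.ofReal_mul' hv.le]
    congr 1
    field_simp
  have hp := hint 1
  have hn := hint (-1)
  simp only [one_mul, neg_mul, neg_neg] at hp hn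
  rw [entropy, hp, hn, if_pos ⟨uniformOn_ac, ENNReal.ofReal_ne_top⟩, EReal.coe_ennreal_ofReal,
    EReal.coe_ennreal_ofReal, ← EReal.coe_sub]
  congr 1
  have := max_zero_sub_eq_self (-Real.log v)
  rwa [neg_neg, max_comm, max_comm 0] at this

theorem expEntropy_uniformOn {m : Measure X} [SigmaFinite m] {A : Set X} (hA : MeasurableSet A)
    (h0 : m A ≠ 0) (h1 : m A ≠ ∞) (N : ℝ) :
    expEntropy N m (uniformOn m A) = m A ^ (1 / N) := by
  have hv : 0 < (m A).toReal := ENNReal.toReal_pos h0 h1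
  rw [expEntropy, entropy_uniformOn hA h0 h1, ← EReal.coe_neg, ← EReal.coe_div, EReal.exp_coe,
    neg_neg, ← ENNReal.ofReal_toReal h1, ENNReal.ofReal_rpow_of_pos hv, ENNReal.toReal_ofReal hv.le,
    Real.rpow_def_of_pos hv]
  congr 2
  ring

/-- Jensen's inequality for the entropy. -/
theorem expEntropy_le {m μ : Measure X} [SigmaFinite m] [IsProbabilityMeasure μ] {E : Set X}
    (hE : MeasurableSet E) (hμE : ∀ᵐ x ∂μ, x ∈ E) {N : ℝ} (hN : 0 < N) :
    expEntropy N m μ ≤ m E ^ (1 / N) := by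
  by_cases h1 : m E = ∞
  · rw [h1, ENNReal.top_rpow_of_pos (by positivity)]; exact le_top
  by_cases hac : μ ≪ m ∧ ∫⁻ x, ENNReal.ofReal (rhoLogRho m μ x) ∂m ≠ ∞
  swap
  · rw [expEntropy, entropy, if_neg hac, EReal.neg_top,
      EReal.bot_div_of_pos_ne_top (by exact_mod_cast hN) (EReal.coe_ne_top N), EReal.exp_bot]
    exact zero_le
  have hμ1 : μ E = 1 := (prob_compl_eq_zero_iff hE).1 hμE
  have h0 : m E ≠ 0 := fun h => by simp [hac.1 h] at hμ1
  set v := (m E).toReal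
  have hv : 0 < v := ENNReal.toReal_pos h0 h1
  have hmeas := Measure.measurable_rnDeriv μ m
  have hmr : Measurable (rhoLogRho m μ) :=
    hmeas.ennreal_toReal.mul (Real.measurable_log.comp hmeas.ennreal_toReal)
  have hzero : ∀ᵐ x ∂m, x ∉ E → μ.rnDeriv m x = 0 := by
    have : ∫⁻ x in Eᶜ, μ.rnDeriv m x ∂m = 0 := by
      rw [Measure.setLIntegral_rnDeriv hac.1]; exact hμE
    rw [lintegral_eq_zero_iff hmeas, Filter.EventuallyEq, ae_restrict_iff' hE.compl] at this
    exact this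
  have hlow : ∀ r : ℝ, 0 ≤ r → (1 - Real.log v) * r - v⁻¹ ≤ r * Real.log r := by
    intro r hr
    rcases hr.eq_or_lt with rfl | hr
    · simp [hv.le]
    · have := Real.one_sub_inv_le_log_of_pos (mul_pos hr hv)
      rw [Real.log_mul hr.ne' hv.ne'] at this
      have h2 := mul_le_mul_of_nonneg_left this hr.le
      have h3 : r * (1 - (r * v)⁻¹) = r - v⁻¹ := by field_simp
      nlinarith
  have hneg : ∫⁻ x, ENNReal.ofReal (-rhoLogRho m μ x) ∂m ≠ ∞ := by
    have : ∀ᵐ x ∂m, ENNReal.ofReal (-rhoLogRho m μ x) ≤ E.indicator (fun _ => 1) x := by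
      filter_upwards [hzero] with x hx
      by_cases h : x ∈ E
      · rw [indicator_of_mem h, ENNReal.ofReal_le_one]
        rcases (ENNReal.toReal_nonneg (a := μ.rnDeriv m x)).eq_or_lt with hr | hr
        · simp [rhoLogRho, ← hr]
        · have := mul_le_mul_of_nonneg_left (Real.one_sub_inv_le_log_of_pos hr) hr.le
          rw [mul_sub, mul_inv_cancel₀ hr.ne'] at this
          unfold rhoLogRho
          linarith
      · simp [rhoLogRho, hx h]
    refine ne_top_of_le_ne_top ?_ (lintegral_mono_ae this)
    simp [hE, h1]
  have hint : Integrable (rhoLogRho m μ) m := by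
    refine ⟨hmr.aestronglyMeasurable, ?_⟩
    rw [hasFiniteIntegral_iff_norm]
    refine lt_of_le_of_lt (lintegral_mono (g := fun x => ENNReal.ofReal (rhoLogRho m μ x) +
      ENNReal.ofReal (-rhoLogRho m μ x)) fun x => ?_) ?_
    · rw [Real.norm_eq_abs]
      rcases abs_cases (rhoLogRho m μ x) with h | h <;> rw [h.1]
      · exact le_self_add
      · exact le_add_self
    · rw [lintegral_add_left hmr.ennreal_ofReal]
      exact ENNReal.add_lt_top.2 ⟨hac.2.lt_top, hneg.lt_top⟩
  have hent : entropy m μ = ((∫ x, rhoLogRho m μ x ∂m : ℝ) : EReal) := by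
    rw [entropy, if_pos hac, integral_eq_lintegral_pos_part_sub_lintegral_neg_part hint,
      EReal.coe_sub, EReal.coe_ennreal_toReal hac.2, EReal.coe_ennreal_toReal hneg]
  have hge : -Real.log v ≤ ∫ x, rhoLogRho m μ x ∂m := by
    have hi1 : Integrable (fun x => (1 - Real.log v) * (μ.rnDeriv m x).toReal) m :=
      Measure.integrable_toReal_rnDeriv.const_mul _
    have hi2 : Integrable (E.indicator fun _ => v⁻¹) m :=
      (integrable_indicator_iff hE).2 (integrableOn_const h1)
    have : ∫ x, ((1 - Real.log v) * (μ.rnDeriv m x).toReal - E.indicator (fun _ => v⁻¹) x) ∂m ≤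
        ∫ x, rhoLogRho m μ x ∂m := by
      apply integral_mono_ae (hi1.sub hi2) hint
      filter_upwards [hzero] with x hx
      by_cases h : x ∈ E
      · rw [Pi.sub_apply, indicator_of_mem h]
        exact hlow _ ENNReal.toReal_nonneg
      · simp [h, rhoLogRho, hx h]
    rw [integral_sub hi1 hi2, integral_const_mul, Measure.integral_toReal_rnDeriv hac.1,
      integral_indicator_const _ hE] at this
    rw [probReal_univ, mul_one, Measure.real, smul_eq_mul, mul_inv_cancel₀ hv.ne'] at this
    linarith
  rw [expEntropy, hent, ← EReal.coe_neg, ← EReal.coe_div, EReal.exp_coe, ← ENNReal.ofReal_toReal h1,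
    ENNReal.ofReal_rpow_of_pos hv, Real.rpow_def_of_pos hv]
  apply ENNReal.ofReal_le_ofReal
  apply Real.exp_le_exp.2
  rw [mul_one_div]
  gcongr
  linarith

variable [MetricSpace X]

theorem isBddProb_uniformOn {m : Measure X} {A : Set X} (hA : MeasurableSet A)
    (hb : Bornology.IsBounded A) (h0 : m A ≠ 0) (h1 : m A ≠ ∞) : IsBddProb (uniformOn m A) where
  prob := isProbabilityMeasure_uniformOn hA h0 h1
  bdd := hb.closure.subset (Measure.support_subset_of_isClosed isClosed_closure
    (Filter.mem_of_superset (ae_mem_uniformOn hA) subset_closure))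

variable [SecondCountableTopology X] [BorelSpace X]

/-- Half of the Brunn-Minkowski inequality. -/
theorem brunnMinkowski (hX : IsCAT0 X) {m : Measure X} [SigmaFinite m] {N : ℝ}
    (hCD : CDZero N m ∨ CDeZero N m) {A B : Set X} (hA : MeasurableSet A) (hB : MeasurableSet B)
    (bA : Bornology.IsBounded A) (bB : Bornology.IsBounded B) (hA0 : m A ≠ 0) (hA1 : m A ≠ ∞)
    (hB0 : m B ≠ 0) (hB1 : m B ≠ ∞) {t : ℝ} (ht : t ∈ Icc (0 : ℝ) 1) {E : Set X} (hE : IsClosed E)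
    (hABE : ∀ x ∈ A, ∀ y ∈ B, hX.point t x y ∈ E) :
    ENNReal.ofReal t * m B ^ (1 / N) ≤ m E ^ (1 / N) := by
  have p₀ := isBddProb_uniformOn hA bA hA0 hA1
  have p₁ := isBddProb_uniformOn hB bB hB0 hB1
  rcases hCD with ⟨hN, h⟩ | ⟨hN, h⟩
  · obtain ⟨μ, π, hμ, hπ, hent⟩ := h _ _ p₀ p₁ uniformOn_ac uniformOn_ac
    have hmem := hμ.ae_mem hX bA bB (ae_mem_uniformOn hA) (ae_mem_uniformOn hB) ht hE hABE
    have := (hμ.bddProb t ht).prob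
    exact (le_lintegral_rnDeriv_uniformOn hB hB0 hB1 hπ.1 N t _).trans
      (le_measure_rpow_of_renyiEntropy_le hE.measurableSet hmem hN (hent t ht))
  · obtain ⟨μ, hμ, hent⟩ := h _ _ p₀ p₁
      (by rw [entropy_uniformOn hA hA0 hA1]; exact EReal.coe_lt_top _)
      (by rw [entropy_uniformOn hB hB0 hB1]; exact EReal.coe_lt_top _)
    have hmem := hμ.ae_mem hX bA bB (ae_mem_uniformOn hA) (ae_mem_uniformOn hB) ht hE hABE
    have := (hμ.bddProb t ht).prob
    have h1 := hent 0 (by simp) 1 (by simp) t ht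
    rw [hμ.target, expEntropy_uniformOn hB hB0 hB1, show (1 - t) * 0 + t * 1 = t by ring] at h1
    exact le_add_self.trans (h1.trans (expEntropy_le hE.measurableSet hmem hN))

end Entropy

/-! ### Measure contraction and properness -/

theorem dimension_pos {X : Type u} [MetricSpace X] [MeasurableSpace X] {m : Measure X} {N : ℝ}
    (hCD : CDZero N m ∨ CDeZero N m) : 0 < N := by
  rcases hCD with h | h
  · exact zero_lt_one.trans_le h.1
  · exact h.1

section Contraction

variable {X : Type u} [MetricSpace X] [MeasurableSpace X]
  [SecondCountableTopology X] [BorelSpace X]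
  {m : Measure X} [IsLocallyFiniteMeasure m] [m.IsOpenPosMeasure] {N : ℝ}

/-- Homotheties contract the measure at most by the `N`-th power of their ratio. -/
theorem measure_contraction (hX : IsCAT0 X) (hCD : CDZero N m ∨ CDeZero N m) (o : X) {B : Set X}
    (hB : MeasurableSet B) (bB : Bornology.IsBounded B) (hB1 : m B ≠ ∞) {t : ℝ}
    (ht : t ∈ Icc (0 : ℝ) 1) {r : ℝ} (hr : 0 < r) :
    ENNReal.ofReal (t ^ N) * m B ≤ m (Metric.cthickening r (hX.point t o '' B)) := by
  have hN := dimension_pos hCD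
  rcases eq_or_ne (m B) 0 with hB0 | hB0
  · simp [hB0]
  obtain ⟨ε, hε, hfin⟩ : ∃ ε > 0, m (Metric.closedBall o ε) ≠ ∞ := by
    obtain ⟨s, hs, hlt⟩ := m.finiteAt_nhds o
    obtain ⟨ε, hε, hsub⟩ := Metric.nhds_basis_closedBall.mem_iff.1 hs
    exact ⟨ε, hε, ((measure_mono hsub).trans_lt hlt).ne⟩
  have hmin : 0 < min ε r := lt_min hε hr
  have key := brunnMinkowski hX hCD (A := Metric.closedBall o (min ε r)) (B := B)
    measurableSet_closedBall hB Metric.isBounded_closedBall bB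
    (Metric.measure_closedBall_pos m o hmin).ne'
    (ne_top_of_le_ne_top hfin (measure_mono (Metric.closedBall_subset_closedBall (min_le_left _ _))))
    hB0 hB1 ht (E := Metric.cthickening r (hX.point t o '' B)) Metric.isClosed_cthickening (by
      intro x hx y hy
      refine Metric.mem_cthickening_of_dist_le _ (hX.point t o y) _ _ (mem_image_of_mem _ hy) ?_
      have h1 := hX.dist_point_point_right ht x o y
      have h2 : dist x o ≤ r := (Metric.mem_closedBall.1 hx).trans (min_le_right _ _)
      have := ht.1
      nlinarith [dist_nonneg (x := x) (y := o)])
  have := ENNReal.rpow_le_rpow key hN.le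
  rwa [ENNReal.mul_rpow_of_nonneg _ _ hN.le, ← ENNReal.rpow_mul, ← ENNReal.rpow_mul,
    one_div_mul_cancel hN.ne', ENNReal.rpow_one, ENNReal.rpow_one,
    ENNReal.ofReal_rpow_of_nonneg ht.1 hN.le] at this

theorem measure_le_of_subset_closedBall (hX : IsCAT0 X) (hCD : CDZero N m ∨ CDeZero N m) (o : X)
    {R ε : ℝ} (hR : 0 ≤ R) (hε : 0 < ε) {B : Set X} (hB : MeasurableSet B)
    (hBR : B ⊆ Metric.closedBall o R) (hB1 : m B ≠ ∞) :
    ENNReal.ofReal ((ε / (2 * (R + ε))) ^ N) * m B ≤ m (Metric.closedBall o ε) := by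
  have ht : ε / (2 * (R + ε)) ∈ Icc (0 : ℝ) 1 :=
    ⟨by positivity, by rw [div_le_one (by positivity)]; linarith⟩
  refine (measure_contraction hX hCD o hB (Metric.isBounded_closedBall.subset hBR) hB1 ht
    (half_pos hε)).trans (measure_mono ?_)
  have : hX.point (ε / (2 * (R + ε))) o '' B ⊆ Metric.closedBall o (ε / 2) := by
    rintro _ ⟨y, hy, rfl⟩
    rw [Metric.mem_closedBall, dist_comm, hX.dist_left_point ht]
    have hy' : dist o y ≤ R := by rw [dist_comm]; exact hBR hy
    calc ε / (2 * (R + ε)) * dist o y ≤ ε / (2 * (R + ε)) * (R + ε) := by gcongr; linarith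
      _ = ε / 2 := by field_simp
  refine (Metric.cthickening_subset_of_subset _ this).trans ?_
  rw [← Metric.cthickening_singleton o (half_pos hε).le, ← Metric.cthickening_singleton o hε.le]
  exact (Metric.cthickening_cthickening_subset (half_pos hε).le (half_pos hε).le _).trans_eq
    (by rw [add_halves])

theorem measure_closedBall_ne_top (hX : IsCAT0 X) (hCD : CDZero N m ∨ CDeZero N m) (o : X) (R : ℝ) :
    m (Metric.closedBall o R) ≠ ∞ := by
  wlog hR : 0 ≤ R
  · rw [Metric.closedBall_eq_empty.2 (not_le.1 hR)]; simp
  obtain ⟨ε, hε, hfin⟩ : ∃ ε > 0, m (Metric.closedBall o ε) ≠ ∞ := by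
    obtain ⟨s, hs, hlt⟩ := m.finiteAt_nhds o
    obtain ⟨ε, hε, hsub⟩ := Metric.nhds_basis_closedBall.mem_iff.1 hs
    exact ⟨ε, hε, ((measure_mono hsub).trans_lt hlt).ne⟩
  have hc : ENNReal.ofReal ((ε / (2 * (R + ε))) ^ N) ≠ 0 := by
    rw [ne_eq, ENNReal.ofReal_eq_zero, not_le]; positivity
  refine ne_top_of_le_ne_top (ENNReal.div_ne_top hfin hc) ?_
  rw [← Measure.iSup_restrict_spanningSets]
  refine iSup_le fun i => ?_
  rw [Measure.restrict_apply measurableSet_closedBall, ENNReal.le_div_iff_mul_le (Or.inl hc)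
    (Or.inl ENNReal.ofReal_ne_top), mul_comm]
  exact measure_le_of_subset_closedBall hX hCD o hR hε
    (measurableSet_closedBall.inter (measurableSet_spanningSets m i)) inter_subset_left
    (ne_top_of_le_ne_top (measure_spanningSets_lt_top m i).ne (measure_mono inter_subset_right))

theorem totallyBounded_closedBall (hX : IsCAT0 X) (hCD : CDZero N m ∨ CDeZero N m) (o : X) (R : ℝ) :
    TotallyBounded (Metric.closedBall o R) := by
  wlog hR : 0 < R
  · exact (this hX hCD o 1 one_pos).subset (Metric.closedBall_subset_closedBall (by linarith))
  rw [Metric.totallyBounded_iff]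
  by_contra! h
  obtain ⟨ε, hε, h⟩ := h
  have hsymm : Std.Symm fun x y : X => ε ≤ dist x y := ⟨fun x y h => by rwa [dist_comm]⟩
  obtain ⟨f, hf, hd⟩ := exists_seq_of_forall_finset_exists' (· ∈ Metric.closedBall o R)
    (fun x y : X => ε ≤ dist x y) (by
      intro s _
      obtain ⟨y, hy, hy'⟩ := not_subset.1 (h s s.finite_toSet)
      refine ⟨y, hy, fun x hx => ?_⟩
      simp only [mem_iUnion, Metric.mem_ball, not_exists, not_lt] at hy'
      rw [dist_comm]
      exact hy' x hx)
  have hδ : 0 < ε / 3 := by positivity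
  set c := ENNReal.ofReal ((ε / 3 / (2 * (2 * R + ε / 3))) ^ N) * m (Metric.closedBall o R)
  have hc : 0 < c := by
    refine ENNReal.mul_pos ?_ (Metric.measure_closedBall_pos m o hR).ne'
    rw [ne_eq, ENNReal.ofReal_eq_zero, not_le]; positivity
  have hlow : ∀ n, c ≤ m (Metric.closedBall (f n) (ε / 3)) := fun n =>
    measure_le_of_subset_closedBall hX hCD (f n) (by positivity) hδ measurableSet_closedBall
      (Metric.closedBall_subset_closedBall' (by
        have := Metric.mem_closedBall.1 (hf n)
        rw [dist_comm] at this
        linarith)) (measure_closedBall_ne_top hX hCD o R)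
  have hfin := Measure.finite_const_le_meas_of_disjoint_iUnion m hc
    (As := fun n => Metric.closedBall (f n) (ε / 3)) (fun _ => measurableSet_closedBall)
    (fun i j hij => Metric.closedBall_disjoint_closedBall (by
      have : ε ≤ dist (f i) (f j) := hd hij
      linarith))
    (ne_top_of_le_ne_top (measure_closedBall_ne_top hX hCD o (R + ε / 3)) (measure_mono
      (iUnion_subset fun n => Metric.closedBall_subset_closedBall' (by
        have := Metric.mem_closedBall.1 (hf n)
        linarith))))
  rw [show {i | c ≤ m (Metric.closedBall (f i) (ε / 3))} = univ from eq_univ_of_forall hlow] at hfin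
  exact infinite_univ hfin

theorem IsCAT0.properSpace (hX : IsCAT0 X) (hCD : CDZero N m ∨ CDeZero N m) : ProperSpace X := by
  have := hX.complete
  exact ⟨fun o R => (totallyBounded_closedBall hX hCD o R).isCompact_of_isClosed
    Metric.isClosed_closedBall⟩

end Contraction

/-! ### The flow towards the end point at infinity of a line -/

section Flow

open Filter Topology

/-- A nonexpanding map of a compact set onto itself preserves distances. -/
theorem dist_eq_of_image_eq_self {X : Type u} [MetricSpace X] {K : Set X} (hK : IsCompact K)
    {f : X → X} (hf : ∀ x y, dist (f x) (f y) ≤ dist x y) (hfK : f '' K = K) {a b : X} (ha : a ∈ K)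
    (hb : b ∈ K) : dist (f a) (f b) = dist a b := by
  have hsurj : ∀ x ∈ K, ∃ y ∈ K, f y = x := fun x hx => by rwa [← hfK] at hx
  choose! g hgK hfg using hsurj
  have hgn : ∀ n, ∀ x ∈ K, g^[n] x ∈ K := fun n => by
    induction n with
    | zero => exact fun x hx => hx
    | succ n ih => exact fun x hx => ih _ (hgK x hx)
  have hfn : ∀ n x y, dist (f^[n] x) (f^[n] y) ≤ dist x y := fun n => by
    induction n with
    | zero => exact fun x y => le_rfl
    | succ n ih => exact fun x y => (ih _ _).trans (hf x y)
  have hfgn : ∀ n, ∀ x ∈ K, f^[n] (g^[n] x) = x := fun n => by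
    induction n with
    | zero => exact fun x _ => rfl
    | succ n ih =>
      intro x hx
      rw [Function.iterate_succ_apply, Function.iterate_succ_apply', hfg _ (hgn n x hx), ih x hx]
  refine le_antisymm (hf a b) (le_of_forall_pos_le_add fun ε hε => ?_)
  obtain ⟨p, -, φ, hφ, hlim⟩ := (hK.prod hK).tendsto_subseq
    (x := fun n => (g^[n] a, g^[n] b)) fun n => ⟨hgn n a ha, hgn n b hb⟩
  obtain ⟨M, hM⟩ := eventually_atTop.1 (hlim.eventually (Metric.ball_mem_nhds p
    (show 0 < ε / 4 by positivity)))
  obtain ⟨k, hk⟩ : ∃ k, φ (M + 1) = φ M + (k + 1) := by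
    obtain ⟨k, hk⟩ := Nat.exists_eq_add_of_lt (hφ (Nat.lt_succ_self M))
    exact ⟨k, by rw [hk]; ring⟩
  have h1 := hM M le_rfl
  have h2 := hM (M + 1) (Nat.le_succ M)
  simp only [Function.comp, Prod.dist_eq, max_lt_iff] at h1 h2
  have hrec : ∀ x ∈ K, dist (g^[φ M] x) (g^[φ (M + 1)] x) < ε / 2 →
      dist x (g (g^[k] x)) < ε / 2 := by
    intro x hx h
    refine lt_of_le_of_lt ?_ h
    have := hfn (φ M) (g^[φ M] x) (g^[φ (M + 1)] x)
    rw [hfgn _ x hx, hk, Function.iterate_add_apply, hfgn _ _ (hgn _ _ hx),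
      Function.iterate_succ_apply'] at this
    rwa [hk, Function.iterate_add_apply, Function.iterate_succ_apply']
  have ra := hrec a ha ((dist_triangle_right _ _ p.1).trans_lt (by linarith [h1.1, h2.1]))
  have rb := hrec b hb ((dist_triangle_right _ _ p.2).trans_lt (by linarith [h1.2, h2.2]))
  have e1 : dist a b ≤ dist (g^[k] a) (g^[k] b) := by
    have := hfn k (g^[k] a) (g^[k] b)
    rwa [hfgn k a ha, hfgn k b hb] at this
  have e2 := dist_triangle4 (g^[k] a) (f a) (f b) (g^[k] b)
  have e3 := hf (g (g^[k] a)) a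
  have e4 := hf b (g (g^[k] b))
  rw [hfg _ (hgn k a ha), dist_comm _ a] at e3
  rw [hfg _ (hgn k b hb)] at e4
  linarith

variable {X : Type u} [MetricSpace X] (hX : IsCAT0 X) {c : ℝ → X}

open Classical in
/-- The time `s` map of the flow along rays asymptotic to the ray `c`: a limit of the maps moving
points by a distance approximately `s` towards `c n`. -/
noncomputable def IsCAT0.flow (c : ℝ → X) (s : ℝ) (x : X) : X :=
  if h : ∃ y, Tendsto (fun n : ℕ => hX.point (1 - s / n) (c n) x) (hyperfilter ℕ) (𝓝 y) then
    h.choose else x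

theorem eventually_one_sub_div_mem {s : ℝ} (hs : 0 ≤ s) :
    ∀ᶠ n : ℕ in atTop, 1 - s / n ∈ Icc (0 : ℝ) 1 := by
  filter_upwards [eventually_ge_atTop (⌈s⌉₊ + 1)] with n hn
  have h1 : s ≤ n := (Nat.le_ceil s).trans (by exact_mod_cast (Nat.le_succ _).trans hn)
  have h2 : (0 : ℝ) < n := by exact_mod_cast lt_of_lt_of_le (Nat.succ_pos _) hn
  exact ⟨by rw [sub_nonneg, div_le_one h2]; exact h1, by linarith [div_nonneg hs h2.le]⟩

theorem tendsto_div_mul_dist (hc : Isometry c) (a : ℝ) (x : X) :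
    Tendsto (fun n : ℕ => a / n * dist (c n) x) atTop (𝓝 a) := by
  have h0 : Tendsto (fun n : ℕ => |a| * dist (c 0) x / n) atTop (𝓝 0) :=
    tendsto_const_div_atTop_nhds_zero_nat _
  rw [tendsto_iff_dist_tendsto_zero]
  refine squeeze_zero' (Eventually.of_forall fun _ => dist_nonneg) ?_ h0
  filter_upwards [eventually_gt_atTop 0] with n hn
  have hn' : (0 : ℝ) < n := by exact_mod_cast hn
  have hd : |dist (c n) x - n| ≤ dist (c 0) x := by
    have h1 := dist_triangle (c n) (c 0) x
    have h2 := dist_triangle_right (c n) (c 0) x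
    rw [hc.dist_eq, Real.dist_eq, sub_zero, abs_of_pos hn'] at h1 h2
    rw [abs_le]
    constructor <;> linarith
  have : a / n * dist (c n) x - a = a / n * (dist (c n) x - n) := by field_simp
  rw [Real.dist_eq, this, abs_mul, abs_div, abs_of_pos hn', mul_div_right_comm]
  gcongr

theorem IsCAT0.tendsto_flow [ProperSpace X] (hc : Isometry c) {s : ℝ} (hs : 0 ≤ s) (x : X) :
    Tendsto (fun n : ℕ => hX.point (1 - s / n) (c n) x) (hyperfilter ℕ) (𝓝 (hX.flow c s x)) := by
  have hbdd : ∀ᶠ n : ℕ in hyperfilter ℕ,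
      hX.point (1 - s / n) (c n) x ∈ Metric.closedBall x (s + 1) := by
    apply Nat.hyperfilter_le_atTop
    filter_upwards [eventually_one_sub_div_mem hs, (tendsto_div_mul_dist hc s x).eventually
      (ge_mem_nhds (lt_add_one s))] with n hn h
    rw [Metric.mem_closedBall, hX.dist_point_right hn]
    simpa using h
  obtain ⟨y, -, hy⟩ := (isCompact_closedBall x (s + 1)).ultrafilter_le_nhds
    ((hyperfilter ℕ).map fun n : ℕ => hX.point (1 - s / n) (c n) x) (le_principal_iff.2 hbdd)
  have h : ∃ y, Tendsto (fun n : ℕ => hX.point (1 - s / n) (c n) x) (hyperfilter ℕ) (𝓝 y) := ⟨y, hy⟩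
  rw [IsCAT0.flow, dif_pos h]
  exact h.choose_spec

theorem IsCAT0.dist_flow_flow [ProperSpace X] (hc : Isometry c) {s t : ℝ} (hs : 0 ≤ s) (ht : 0 ≤ t)
    (x : X) : dist (hX.flow c s x) (hX.flow c t x) = |s - t| := by
  refine tendsto_nhds_unique ((hX.tendsto_flow hc hs x).dist (hX.tendsto_flow hc ht x)) ?_
  refine ((tendsto_div_mul_dist hc |s - t| x).mono_left Nat.hyperfilter_le_atTop).congr' ?_
  apply Nat.hyperfilter_le_atTop
  filter_upwards [eventually_one_sub_div_mem hs, eventually_one_sub_div_mem ht] with n h1 h2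
  rw [hX.dist_point_point h1 h2, show 1 - s / n - (1 - t / n) = -((s - t) / n) by ring, abs_neg,
    abs_div, Nat.abs_cast]

theorem IsCAT0.dist_flow_le [ProperSpace X] (hc : Isometry c) {s : ℝ} (hs : 0 ≤ s) (x y : X) :
    dist (hX.flow c s x) (hX.flow c s y) ≤ dist x y := by
  refine le_of_tendsto ((hX.tendsto_flow hc hs x).dist (hX.tendsto_flow hc hs y)) ?_
  apply Nat.hyperfilter_le_atTop
  filter_upwards [eventually_one_sub_div_mem hs] with n h
  exact (hX.dist_point_point_left h _ _ _).trans (mul_le_of_le_one_left dist_nonneg h.2)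

theorem IsCAT0.flow_flow [ProperSpace X] (hc : Isometry c) {s t : ℝ} (hs : 0 ≤ s) (ht : 0 ≤ t)
    (x : X) : hX.flow c s (hX.flow c t x) = hX.flow c (s + t) x := by
  refine tendsto_nhds_unique (hX.tendsto_flow hc hs _) ?_
  refine tendsto_of_tendsto_of_dist (hX.tendsto_flow hc (add_nonneg hs ht) x) ?_
  have h1 : Tendsto (fun n : ℕ => dist (hX.point (1 - t / n) (c n) x) (hX.flow c t x) +
      |s * t| / n * (1 / n * dist (c n) x)) (hyperfilter ℕ) (𝓝 (0 + 0 * 1)) :=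
    (tendsto_iff_dist_tendsto_zero.1 (hX.tendsto_flow hc ht x)).add
      (((tendsto_const_div_atTop_nhds_zero_nat _).mul (tendsto_div_mul_dist hc 1 x)).mono_left
        Nat.hyperfilter_le_atTop)
  rw [zero_mul, add_zero] at h1
  refine squeeze_zero' (Eventually.of_forall fun _ => dist_nonneg) ?_ h1
  apply Nat.hyperfilter_le_atTop
  filter_upwards [eventually_one_sub_div_mem hs, eventually_one_sub_div_mem ht,
    eventually_one_sub_div_mem (add_nonneg hs ht)] with n hs' ht' hst'
  refine (dist_triangle_right _ _ (hX.point (1 - s / n) (c n)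
    (hX.point (1 - t / n) (c n) x))).trans ?_
  rw [add_comm]
  gcongr ?_ + ?_
  · rw [dist_comm (hX.point (1 - t / n) (c n) x)]
    exact (hX.dist_point_point_left hs' _ _ _).trans (mul_le_of_le_one_left dist_nonneg hs'.2)
  · rw [hX.point_point hs' ht', hX.dist_point_point hst'
      ⟨mul_nonneg hs'.1 ht'.1, mul_le_one₀ hs'.2 ht'.1 ht'.2⟩,
      show 1 - (s + t) / n - (1 - s / n) * (1 - t / n) = -(s * t / n / n) by ring, abs_neg, abs_div,
      abs_div, Nat.abs_cast]
    apply le_of_eq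
    ring

theorem IsCAT0.flow_line [ProperSpace X] (hc : Isometry c) {s : ℝ} (hs : 0 ≤ s) (u : ℝ) :
    hX.flow c s (c u) = c (u + s) := by
  refine tendsto_nhds_unique (hX.tendsto_flow hc hs _) ?_
  have h1 : Tendsto (fun n : ℕ => c (u + (s - s * u / n))) atTop (𝓝 (c (u + (s - 0)))) :=
    (hc.continuous.tendsto _).comp (tendsto_const_nhds.add (tendsto_const_nhds.sub
      (tendsto_const_div_atTop_nhds_zero_nat _)))
  rw [sub_zero] at h1
  refine (h1.congr' ?_).mono_left Nat.hyperfilter_le_atTop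
  filter_upwards [eventually_one_sub_div_mem hs, eventually_gt_atTop 0] with n h hn
  have hn' : (0 : ℝ) < n := by exact_mod_cast hn
  apply hX.eq_point h
  · rw [hc.dist_eq, hc.dist_eq, Real.dist_eq, Real.dist_eq, ← abs_of_nonneg h.1, ← abs_mul]
    congr 1
    field_simp
    ring
  · rw [hc.dist_eq, hc.dist_eq, Real.dist_eq, Real.dist_eq, sub_sub_cancel,
      ← abs_of_nonneg (div_nonneg hs hn'.le), ← abs_mul]
    congr 1
    field_simp
    ring

end Flow

/-! ### The flow consists of isometries -/

section FlowIsometry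

open Filter Topology

theorem isometry_comp_neg {X : Type u} [MetricSpace X] {c : ℝ → X} (hc : Isometry c) :
    Isometry fun u => c (-u) :=
  hc.comp (IsometryEquiv.neg ℝ).isometry

theorem IsCAT0.closure_ball {X : Type u} [MetricSpace X] (hX : IsCAT0 X) (o : X) {r : ℝ}
    (hr : 0 < r) : closure (Metric.ball o r) = Metric.closedBall o r := by
  refine Metric.closure_ball_subset_closedBall.antisymm fun x hx => ?_
  have hx' : dist o x ≤ r := by rw [dist_comm]; exact hx
  rw [Metric.mem_closure_iff]
  intro ε hε
  have hd : 0 < r + ε := by positivity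
  have ht : r / (r + ε) ∈ Icc (0 : ℝ) 1 :=
    ⟨by positivity, by rw [div_le_one hd]; linarith⟩
  have ht1 : r / (r + ε) < 1 := by rw [div_lt_one hd]; linarith
  refine ⟨hX.point (r / (r + ε)) o x, ?_, ?_⟩
  · rw [Metric.mem_ball, dist_comm, hX.dist_left_point ht]
    nlinarith [ht.1]
  · rw [dist_comm, hX.dist_point_right ht]
    have : (1 - r / (r + ε)) * r < ε := by
      have : (1 - r / (r + ε)) * r = ε * (r / (r + ε)) := by field_simp; ring
      rw [this]
      nlinarith
    nlinarith

variable {X : Type u} [MetricSpace X] [MeasurableSpace X]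
  [SecondCountableTopology X] [BorelSpace X] [ProperSpace X]
  {m : Measure X} [IsLocallyFiniteMeasure m] [m.IsOpenPosMeasure] {N : ℝ} {c : ℝ → X}

/-- The flow does not decrease the measure of compact sets. -/
theorem measure_le_measure_image_flow (hX : IsCAT0 X) (hCD : CDZero N m ∨ CDeZero N m)
    (hc : Isometry c) {s : ℝ} (hs : 0 ≤ s) {K : Set X} (hK : IsCompact K) :
    m K ≤ m (hX.flow c s '' K) := by
  have hN := dimension_pos hCD
  have hcont : Continuous (hX.flow c s) :=
    (LipschitzWith.of_dist_le_mul (K := 1) fun x y => by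
      simpa using hX.dist_flow_le hc hs x y).continuous
  have key : ∀ δ > 0, m K ≤ m (Metric.cthickening δ (hX.flow c s '' K)) := by
    intro δ hδ
    have hlim : Tendsto (fun n : ℕ => ENNReal.ofReal ((1 - s / n) ^ N) * m K) (hyperfilter ℕ)
        (𝓝 (1 * m K)) := by
      refine ENNReal.Tendsto.mul_const ?_ (Or.inl one_ne_zero)
      have h1 : Tendsto (fun n : ℕ => 1 - s / n) atTop (𝓝 (1 - 0)) :=
        tendsto_const_nhds.sub (tendsto_const_div_atTop_nhds_zero_nat s)
      have h2 := ENNReal.tendsto_ofReal (h1.rpow_const (p := N) (Or.inl (by norm_num)))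
      simp only [sub_zero, Real.one_rpow, ENNReal.ofReal_one] at h2
      exact h2.mono_left Nat.hyperfilter_le_atTop
    rw [one_mul] at hlim
    obtain ⟨F, -, hF, hcov⟩ := Metric.finite_approx_of_totallyBounded hK.totallyBounded (δ / 4)
      (by positivity)
    refine le_of_tendsto hlim ?_
    have hnet : ∀ᶠ n : ℕ in hyperfilter ℕ, ∀ y ∈ F,
        dist (hX.point (1 - s / n) (c n) y) (hX.flow c s y) < δ / 4 :=
      (eventually_all_finite hF).2 fun y _ =>
        (hX.tendsto_flow hc hs y).eventually (Metric.ball_mem_nhds _ (by positivity))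
    filter_upwards [hnet, Nat.hyperfilter_le_atTop (eventually_one_sub_div_mem hs)] with n hn ht
    refine (measure_contraction hX hCD (c n) hK.measurableSet hK.isBounded hK.measure_lt_top.ne ht
      (r := δ / 4) (by positivity)).trans (measure_mono ?_)
    have hsub : hX.point (1 - s / n) (c n) '' K ⊆
        Metric.cthickening (3 * δ / 4) (hX.flow c s '' K) := by
      rintro _ ⟨x, hx, rfl⟩
      obtain ⟨y, hy, hxy⟩ := mem_iUnion₂.1 (hcov hx)
      have hxy' : dist x y < δ / 4 := hxy
      refine Metric.mem_cthickening_of_dist_le _ _ _ _ (mem_image_of_mem _ hx) ?_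
      have h1 := (hX.dist_point_point_left ht (c n) x y).trans
        (mul_le_of_le_one_left dist_nonneg ht.2)
      have h2 := hX.dist_flow_le hc hs y x
      rw [dist_comm y x] at h2
      have h3 := dist_triangle4 (hX.point (1 - s / n) (c n) x) (hX.point (1 - s / n) (c n) y)
        (hX.flow c s y) (hX.flow c s x)
      have h4 := hn y hy
      linarith
    refine (Metric.cthickening_subset_of_subset _ hsub).trans ?_
    refine (Metric.cthickening_cthickening_subset (by positivity) (by positivity) _).trans_eq ?_
    congr 1
    ring
  exact ge_of_tendsto ((tendsto_measure_cthickening_of_isCompact (hK.image hcont)).mono_left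
    (nhdsWithin_le_nhds (s := Ioi 0))) (eventually_mem_nhdsWithin.mono fun δ hδ => key δ hδ)

/-- Flowing forth towards one end of the line and back towards the other one is a surjective map
that preserves distances. -/
theorem flow_back_forth (hX : IsCAT0 X) (hCD : CDZero N m ∨ CDeZero N m) (hc : Isometry c) {s : ℝ}
    (hs : 0 ≤ s) :
    Isometry (hX.flow (fun u => c (-u)) s ∘ hX.flow c s) ∧
      Function.Surjective (hX.flow (fun u => c (-u)) s ∘ hX.flow c s) := by
  have hc' := isometry_comp_neg hc
  set Ψ := hX.flow (fun u => c (-u)) s ∘ hX.flow c s with hΨ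
  have hnon : ∀ x y, dist (Ψ x) (Ψ y) ≤ dist x y := fun x y =>
    (hX.dist_flow_le hc' hs _ _).trans (hX.dist_flow_le hc hs _ _)
  have hcont : ∀ {d : ℝ → X}, Isometry d → Continuous (hX.flow d s) := fun hd =>
    (LipschitzWith.of_dist_le_mul (K := 1) fun x y => by
      simpa using hX.dist_flow_le hd hs x y).continuous
  have hfix : Ψ (c 0) = c 0 := by
    have h1 := hX.flow_line hc hs 0
    have h2 := hX.flow_line hc' hs (-s)
    simp only [zero_add, neg_neg, neg_add_cancel, neg_zero] at h1 h2
    rw [hΨ, Function.comp_apply, h1, h2]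
  have himage : ∀ r > 0, Ψ '' Metric.closedBall (c 0) r = Metric.closedBall (c 0) r := by
    intro r hr
    have hK := isCompact_closedBall (c 0) r
    have hΨK : IsCompact (Ψ '' Metric.closedBall (c 0) r) :=
      hK.image ((hcont hc').comp (hcont hc))
    have hsub : Ψ '' Metric.closedBall (c 0) r ⊆ Metric.closedBall (c 0) r := by
      rintro _ ⟨x, hx, rfl⟩
      rw [Metric.mem_closedBall, ← hfix]
      exact (hnon _ _).trans hx
    refine hsub.antisymm ?_
    have hle : m (Metric.closedBall (c 0) r) ≤ m (Ψ '' Metric.closedBall (c 0) r) := by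
      rw [hΨ, image_comp]
      exact (measure_le_measure_image_flow hX hCD hc hs hK).trans
        (measure_le_measure_image_flow hX hCD hc' hs (hK.image (hcont hc)))
    have hzero : m (Metric.ball (c 0) r \ Ψ '' Metric.closedBall (c 0) r) = 0 := by
      refine measure_mono_null (sdiff_subset_sdiff_left Metric.ball_subset_closedBall) ?_
      rw [measure_sdiff hsub hΨK.measurableSet.nullMeasurableSet hΨK.measure_lt_top.ne,
        tsub_eq_zero_of_le hle]
    have hempty := (Metric.isOpen_ball.sdiff hΨK.isClosed).measure_eq_zero_iff m |>.1 hzero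
    calc _ = closure (Metric.ball (c 0) r) := (hX.closure_ball (c 0) hr).symm
      _ ⊆ _ := closure_minimal (sdiff_eq_empty.1 hempty) hΨK.isClosed
  constructor
  · refine Isometry.of_dist_eq fun x y => ?_
    have hr : 0 < max (dist x (c 0)) (dist y (c 0)) + 1 := by positivity
    exact dist_eq_of_image_eq_self (isCompact_closedBall (c 0) _) hnon (himage _ hr)
      (Metric.mem_closedBall.2 ((le_max_left _ _).trans (le_add_of_nonneg_right zero_le_one)))
      (Metric.mem_closedBall.2 ((le_max_right _ _).trans (le_add_of_nonneg_right zero_le_one)))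
  · intro y
    have hr : 0 < dist y (c 0) + 1 := by positivity
    have : y ∈ Ψ '' Metric.closedBall (c 0) (dist y (c 0) + 1) := by
      rw [himage _ hr, Metric.mem_closedBall]; linarith
    obtain ⟨x, -, hx⟩ := this
    exact ⟨x, hx⟩

theorem isometry_flow (hX : IsCAT0 X) (hCD : CDZero N m ∨ CDeZero N m) (hc : Isometry c) {s : ℝ}
    (hs : 0 ≤ s) : Isometry (hX.flow c s) := by
  refine Isometry.of_dist_eq fun x y => (hX.dist_flow_le hc hs x y).antisymm ?_
  rw [← (flow_back_forth hX hCD hc hs).1.dist_eq]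
  exact hX.dist_flow_le (isometry_comp_neg hc) hs _ _

theorem surjective_flow (hX : IsCAT0 X) (hCD : CDZero N m ∨ CDeZero N m) (hc : Isometry c) {s : ℝ}
    (hs : 0 ≤ s) : Function.Surjective (hX.flow c s) := by
  have := (flow_back_forth hX hCD (isometry_comp_neg hc) hs).2
  simp only [neg_neg] at this
  exact this.of_comp

end FlowIsometry

/-! ### Groups of translations of CAT(0) spaces -/

section Translation

open Filter Topology

/-- An action of `ℝ` by isometries whose orbits are unit speed lines. -/
structure IsTranslationGroup {X : Type u} [MetricSpace X] (T : ℝ → X → X) : Prop where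
  isometry : ∀ s, Isometry (T s)
  add : ∀ s t x, T (s + t) x = T s (T t x)
  dist_eq : ∀ s t x, dist (T s x) (T t x) = |s - t|

theorem exists_isTranslationGroup {X : Type u} [MetricSpace X] {Φ : ℝ → X → X}
    (hi : ∀ s, 0 ≤ s → Isometry (Φ s)) (hs : ∀ s, 0 ≤ s → Function.Surjective (Φ s))
    (ha : ∀ s t, 0 ≤ s → 0 ≤ t → ∀ x, Φ s (Φ t x) = Φ (s + t) x)
    (hd : ∀ s t, 0 ≤ s → 0 ≤ t → ∀ x, dist (Φ s x) (Φ t x) = |s - t|) :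
    ∃ T : ℝ → X → X, IsTranslationGroup T := by
  have hex : ∀ s x, ∃ y, Φ |s| y = Φ (|s| + s) x := fun s x => hs _ (abs_nonneg s) _
  choose T hT using hex
  have key : ∀ a s, 0 ≤ a → 0 ≤ a + s → ∀ x, Φ a (T s x) = Φ (a + s) x := by
    intro a s h1 h2 x
    have h3 : 0 ≤ |s| + s := by linarith [neg_abs_le s]
    apply (hi |s| (abs_nonneg s)).injective
    rw [ha _ _ (abs_nonneg s) h1, add_comm, ← ha _ _ h1 (abs_nonneg s), hT, ha _ _ h1 h3,
      ha _ _ (abs_nonneg s) h2]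
    congr 1
    ring
  refine ⟨T, fun s => Isometry.of_dist_eq fun x y => ?_, fun s t x => ?_, fun s t x => ?_⟩
  · have h3 : 0 ≤ |s| + s := by linarith [neg_abs_le s]
    rw [← (hi |s| (abs_nonneg s)).dist_eq, hT, hT, (hi _ h3).dist_eq]
  · have h1 := neg_abs_le s
    have h2 := neg_abs_le t
    have h3 := abs_nonneg s
    have h4 := abs_nonneg t
    have h0 : 0 ≤ |s| + |t| := by positivity
    apply (hi _ h0).injective
    rw [key _ _ h0 (by linarith), key _ _ h0 (by linarith), key _ _ (by linarith) (by linarith),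
      add_assoc _ s t]
  · have h1 := neg_abs_le s
    have h2 := neg_abs_le t
    have h3 := abs_nonneg s
    have h4 := abs_nonneg t
    have h0 : 0 ≤ |s| + |t| := by positivity
    rw [← (hi _ h0).dist_eq, key _ _ h0 (by linarith), key _ _ h0 (by linarith),
      hd _ _ (by linarith) (by linarith)]
    congr 1
    ring

namespace IsTranslationGroup

variable {X : Type u} [MetricSpace X] {T : ℝ → X → X}

theorem zero (hT : IsTranslationGroup T) (x : X) : T 0 x = x :=
  (hT.isometry 0).injective (by rw [← hT.add, add_zero])

theorem dist_neg (hT : IsTranslationGroup T) (s : ℝ) (x y : X) :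
    dist x (T (-s) y) = dist (T s x) y := by
  rw [← (hT.isometry s).dist_eq, ← hT.add, add_neg_cancel, hT.zero]

theorem dist_self_translate (hT : IsTranslationGroup T) (s : ℝ) (x : X) : dist x (T s x) = |s| := by
  have := hT.dist_eq 0 s x
  rwa [hT.zero, zero_sub, abs_neg] at this

theorem parallelogram (hT : IsTranslationGroup T) (hX : IsCAT0 X) (a : ℝ) (x y : X) :
    dist x (T a y) ^ 2 + dist x (T (-a) y) ^ 2 = 2 * a ^ 2 + 2 * dist x y ^ 2 := by
  apply le_antisymm
  · have := hX.quadrilateral x (T a x) (T a y) y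
    rw [(hT.isometry a).dist_eq, hT.dist_self_translate, dist_comm (T a y) y,
      hT.dist_self_translate, sq_abs] at this
    rw [hT.dist_neg]
    linarith
  · have hh : (1 / 2 : ℝ) ∈ Icc (0 : ℝ) 1 := by norm_num
    have hd : dist (T (-a) y) (T a y) = 2 * |a| := by
      rw [hT.dist_eq, show -a - a = -(2 * a) by ring, abs_neg, abs_mul, abs_two]
    have hy : y = hX.point (1 / 2) (T (-a) y) (T a y) := by
      apply hX.eq_point hh
      · rw [hd, dist_comm, hT.dist_self_translate, abs_neg]; ring
      · rw [hd, hT.dist_self_translate]; ring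
    have := hX.dist_sq_point_le hh x (T (-a) y) (T a y)
    rw [← hy, hd, mul_pow, sq_abs] at this
    linarith

/-- The Busemann cocycle of the ends of the orbits. -/
noncomputable def cocycle (T : ℝ → X → X) (x y : X) : ℝ :=
  (dist x (T 1 y) ^ 2 - 1 - dist x y ^ 2) / 2

theorem dist_sq (hT : IsTranslationGroup T) (hX : IsCAT0 X) (s : ℝ) (x y : X) :
    dist x (T s y) ^ 2 = s ^ 2 + 2 * s * cocycle T x y + dist x y ^ 2 := by
  set f : ℝ → ℝ := fun s => dist x (T s y) ^ 2 - s ^ 2 with hf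
  have hcont : Continuous f := by
    have : Continuous fun s => T s y :=
      (Isometry.of_dist_eq fun s t => by rw [hT.dist_eq, Real.dist_eq]).continuous
    fun_prop
  have hmid : ∀ s a, f (s + a) + f (s - a) = 2 * f s := by
    intro s a
    have := hT.parallelogram hX a x (T s y)
    rw [← hT.add, ← hT.add, add_comm a, neg_add_eq_sub] at this
    simp only [hf]
    linear_combination this
  let g : ℝ →+ ℝ := AddMonoidHom.mk' (fun s => f s - f 0) (by
    intro s t
    have h1 := hmid ((s + t) / 2) ((s - t) / 2)
    have h2 := hmid ((s + t) / 2) ((s + t) / 2)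
    ring_nf at h1 h2 ⊢
    linarith)
  have hg : Continuous g := hcont.sub continuous_const
  have h1 := map_real_smul g hg s 1
  simp only [smul_eq_mul, mul_one] at h1
  have e : ∀ s, g s = f s - f 0 := fun s => rfl
  rw [e, e] at h1
  simp only [hf, hT.zero] at h1
  rw [cocycle]
  linear_combination h1

theorem cocycle_translate (hT : IsTranslationGroup T) (hX : IsCAT0 X) (r : ℝ) (x y : X) :
    cocycle T x (T r y) = cocycle T x y + r := by
  rw [cocycle, ← hT.add, hT.dist_sq hX, hT.dist_sq hX]
  ring

theorem cocycle_symm (hT : IsTranslationGroup T) (hX : IsCAT0 X) (x y : X) :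
    cocycle T y x = -cocycle T x y := by
  have h := hT.dist_sq hX (-1) x y
  rw [hT.dist_neg, dist_comm] at h
  rw [cocycle, h, dist_comm y x]
  ring

theorem tendsto_cocycle (hT : IsTranslationGroup T) (hX : IsCAT0 X) (x y : X) :
    Tendsto (fun s => dist x (T s y) - s) atTop (𝓝 (cocycle T x y)) := by
  set B := cocycle T x y
  have h0 : Tendsto (fun s => |dist x y ^ 2 - B ^ 2| / (s + B)) atTop (𝓝 0) :=
    tendsto_const_nhds.div_atTop (tendsto_atTop_add_const_right _ _ tendsto_id)
  rw [tendsto_iff_dist_tendsto_zero]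
  refine squeeze_zero' (Eventually.of_forall fun _ => dist_nonneg) ?_ h0
  filter_upwards [eventually_gt_atTop (-B)] with s hs
  have hs' : 0 < s + B := by linarith
  rw [Real.dist_eq, le_div_iff₀ hs']
  have h1 : dist x y ^ 2 - B ^ 2 = (dist x (T s y) - s - B) * (dist x (T s y) + (s + B)) := by
    have := hT.dist_sq hX s x y
    linear_combination -this
  rw [h1, abs_mul]
  gcongr
  exact (le_add_of_nonneg_left dist_nonneg).trans (le_abs_self _)

theorem cocycle_add (hT : IsTranslationGroup T) (hX : IsCAT0 X) (x y z : X) :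
    cocycle T x y + cocycle T y z = cocycle T x z := by
  have hle : ∀ x y z, cocycle T x z ≤ cocycle T x y + cocycle T y z := by
    intro x y z
    have h1 : Tendsto (fun s : ℝ => dist x (T (2 * s) z) - 2 * s) atTop (𝓝 (cocycle T x z)) :=
      (hT.tendsto_cocycle hX x z).comp (tendsto_id.const_mul_atTop two_pos)
    refine le_of_tendsto_of_tendsto' h1
      ((hT.tendsto_cocycle hX x y).add (hT.tendsto_cocycle hX y z)) fun s => ?_
    have := dist_triangle x (T s y) (T (2 * s) z)
    rw [two_mul, hT.add, (hT.isometry s).dist_eq] at this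
    rw [two_mul, hT.add]
    linarith
  apply le_antisymm _ (hle x y z)
  have := hle z y x
  rw [hT.cocycle_symm hX x z, hT.cocycle_symm hX y z, hT.cocycle_symm hX x y] at this
  linarith

theorem cocycle_point (hT : IsTranslationGroup T) (hX : IsCAT0 X) {t : ℝ} (ht : t ∈ Icc (0 : ℝ) 1)
    (x y w : X) :
    cocycle T (hX.point t x y) w = (1 - t) * cocycle T x w + t * cocycle T y w := by
  set z := hX.point t x y
  set K := (1 - t) * dist x w ^ 2 + t * dist y w ^ 2 - t * (1 - t) * dist x y ^ 2 - dist z w ^ 2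
  have h : ∀ s : ℝ, 2 * s * (cocycle T z w - ((1 - t) * cocycle T x w + t * cocycle T y w)) ≤ K := by
    intro s
    have := hX.dist_sq_point_le ht (T s w) x y
    rw [dist_comm _ x, dist_comm _ y, dist_comm _ (hX.point t x y), hT.dist_sq hX, hT.dist_sq hX,
      hT.dist_sq hX] at this
    linarith
  by_contra hne
  have hne' := sub_ne_zero.2 hne
  have := h ((K + 1) / (2 * (cocycle T z w - ((1 - t) * cocycle T x w + t * cocycle T y w))))
  field_simp at this
  linarith

theorem continuous_cocycle (hT : IsTranslationGroup T) (x : X) : Continuous (cocycle T x) := by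
  have := (hT.isometry 1).continuous
  unfold cocycle
  fun_prop

theorem dist_sq_eq (hT : IsTranslationGroup T) (hX : IsCAT0 X) (s t : ℝ) (x y : X)
    (h : cocycle T x y = 0) : dist (T s x) (T t y) ^ 2 = dist x y ^ 2 + |s - t| ^ 2 := by
  have h1 := hT.dist_neg (-s) x (T t y)
  have : dist (T s x) (T t y) = dist x (T (t - s) y) := by
    rw [← hT.dist_neg, ← hT.add, neg_add_eq_sub]
  rw [this, hT.dist_sq hX, h, sq_abs]
  ring

end IsTranslationGroup

/-- A closed convex subset of a CAT(0) space is CAT(0). -/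
theorem IsCAT0.subtype {X : Type u} [MetricSpace X] (hX : IsCAT0 X) {S : Set X} (hS : IsClosed S)
    (hconv : ∀ x ∈ S, ∀ y ∈ S, ∀ t ∈ Icc (0 : ℝ) 1, hX.point t x y ∈ S) : IsCAT0 S where
  complete := by
    have := hX.complete
    exact hS.completeSpace_coe
  geodesic x y := by
    classical
    have hd : dist x y = dist (x : X) y := rfl
    have hmem : ∀ s ∈ Icc (0 : ℝ) (dist x y), (hX.geodesic x y).choose s ∈ S := by
      intro s hs
      rcases (dist_nonneg (x := x) (y := y)).eq_or_lt with h | h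
      · rw [← h, Icc_self, mem_singleton_iff] at hs
        rw [hs, (hX.geodesic x y).choose_spec.source]
        exact x.2
      · have := hconv x x.2 y y.2 (s / dist x y) ⟨div_nonneg hs.1 h.le, div_le_one_of_le₀ hs.2 h.le⟩
        rwa [IsCAT0.point, hd, div_mul_cancel₀ _ (hd ▸ h.ne')] at this
    refine ⟨fun s => if h : (hX.geodesic x y).choose s ∈ S then ⟨_, h⟩ else x, ?_, ?_, ?_⟩
    · rw [dif_pos (hmem 0 ⟨le_rfl, dist_nonneg⟩)]
      exact Subtype.ext (hX.geodesic x y).choose_spec.source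
    · rw [dif_pos (hmem _ ⟨dist_nonneg, le_rfl⟩)]
      exact Subtype.ext (hX.geodesic x y).choose_spec.target
    · intro s hs t ht
      rw [dif_pos (hmem s hs), dif_pos (hmem t ht)]
      exact (hX.geodesic x y).choose_spec.dist_eq s hs t ht
  comparison x y z γ hγ t ht x' y' z' q' h1 h2 h3 h4 h5 :=
    hX.comparison x y z (fun s => γ s)
      ⟨congrArg Subtype.val hγ.source, congrArg Subtype.val hγ.target, hγ.dist_eq⟩
      t ht x' y' z' q' h1 h2 h3 h4 h5

/-- A CAT(0) space with a group of translations splits off a line. -/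
theorem IsTranslationGroup.exists_splitting {X : Type u} [MetricSpace X] {T : ℝ → X → X}
    (hT : IsTranslationGroup T) (hX : IsCAT0 X) (o : X) :
    ∃ (Y : Type u) (_ : MetricSpace Y), IsCAT0 Y ∧ Nonempty (X ≃ᵢ WithLp 2 (Y × ℝ)) := by
  have hproj : ∀ x, cocycle T o (T (-cocycle T o x) x) = 0 := fun x => by
    rw [hT.cocycle_translate hX, add_neg_cancel]
  refine ⟨{x : X | cocycle T o x = 0}, inferInstance, ?_, ⟨IsometryEquiv.symm (IsometryEquiv.mk'
    (fun p => T p.snd p.fst) (fun x => WithLp.toLp 2 (⟨T (-cocycle T o x) x, hproj x⟩, cocycle T o x))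
    (fun x => ?_) (Isometry.of_dist_eq fun p q => ?_))⟩⟩
  · refine hX.subtype (isClosed_singleton.preimage (hT.continuous_cocycle o)) ?_
    intro x hx y hy t ht
    change cocycle T o x = 0 at hx
    change cocycle T o y = 0 at hy
    change cocycle T o (hX.point t x y) = 0
    rw [hT.cocycle_symm hX, hT.cocycle_point hX ht, hT.cocycle_symm hX o, hT.cocycle_symm hX o, hx,
      hy]
    ring
  · change T (cocycle T o x) (T _ x) = x
    rw [← hT.add, add_neg_cancel, hT.zero]
  · have h0 : cocycle T (p.fst : X) q.fst = 0 := by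
      rw [← hT.cocycle_add hX _ o, hT.cocycle_symm hX o, p.fst.2, q.fst.2]
      ring
    rw [WithLp.prod_dist_eq_add (by simp), ENNReal.toReal_ofNat, Real.rpow_two, Real.rpow_two,
      ← Real.sqrt_eq_rpow, ← Real.sqrt_sq (dist_nonneg (x := T p.snd p.fst)),
      hT.dist_sq_eq hX _ _ _ _ h0]
    rfl

end Translation

end CATSplitting

theorem proposition5p3 {X : Type u} [MetricSpace X] [TopologicalSpace.SeparableSpace X]
    [MeasurableSpace X] [BorelSpace X]
    (m : MeasureTheory.Measure X) [MeasureTheory.IsLocallyFiniteMeasure m] [m.IsOpenPosMeasure]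
    (hX : CATSplitting.IsCAT0 X)
    (N : ℝ) (hCD : CATSplitting.CDZero N m ∨ CATSplitting.CDeZero N m)
    (γ : ℝ → X) (hγ : Isometry γ) :
    ∃ (Y : Type u) (_ : MetricSpace Y),
      CATSplitting.IsCAT0 Y ∧ Nonempty (X ≃ᵢ WithLp 2 (Y × ℝ)) := by
  have := UniformSpace.secondCountable_of_separable X
  have := hX.properSpace hCD
  obtain ⟨T, hT⟩ := CATSplitting.exists_isTranslationGroup (Φ := hX.flow γ)
    (fun _ hs => CATSplitting.isometry_flow hX hCD hγ hs)
    (fun _ hs => CATSplitting.surjective_flow hX hCD hγ hs)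
    (fun _ _ hs ht => hX.flow_flow hγ hs ht) (fun _ _ hs ht => hX.dist_flow_flow hγ hs ht)
  exact hT.exists_splitting hX (γ 0)
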